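/- For a Borel probability measure $\mu$ on $\mathbb{C}$ whose support is an infinite subset of the unit circle $\partial\mathbb{D}$, let $\Phi_n(\cdot;\mu)$, $n\ge 0$, be the monic orthogonal polynomials of $\mu$ (obtained by Gram–Schmidt orthogonalization of $1,z,z^2,\dots$ in $L^2(\mathbb{C},\mu)$, with leading coefficient $1$), and for $n\ge 1$ let $$\Phi_n^{(-1)}(z;\mu)=z\,\Phi_{n-1}(z;\mu)+z^{n-1}\,\overline{\Phi_{n-1}(1/\bar z;\mu)}$$ be the degree $n$ paraorthogonal polynomial. (i) Let $\mu$ be a probability measure whose support is an infinite subset of $\partial\mathbb{D}$, let $\mathcal N=\{n_1<n_2<\cdots\}$ be an infinite set of positive integers and let $f$ be a function such that $$\lim_{n\to\infty,\ n\in\mathcal N}\frac{\Phi_{n-1}(z;\mu)}{\Phi_n^{(-1)}(z;\mu)}=f(z)\quad\text{for every } z\in\mathbb{C} \text{ with } |z|>1. \qquad (1)$$ Then there is a probability measure $\nu$ supported on $\partial\mathbb{D}$ such that $$f(z)=\int_{\partial\mathbb{D}}\frac{1}{z-w}\,d\nu(w)\quad\text{for every } z\in\mathbb{C} \text{ with }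 |z|>1. \qquad (2)$$ (ii) Conversely, if $\nu$ is any probability measure supported on $\partial\mathbb{D}$ and $f$ is given by (2), then there are a probability measure $\mu$ whose support is an infinite subset of $\partial\mathbb{D}$ and an infinite set $\mathcal N$ of positive integers such that (1) holds. -/

import Mathlib

open MeasureTheory Filter Topology Polynomial

noncomputable section

namespace CirclePolynomials

/-- The inner product `∫ conj(P(w)) Q(w) dμ(w)` of two polynomials in `L²(ℂ, μ)`. -/
def polyInner (μ : Measure ℂ) (P Q : ℂ[X]) : ℂ :=
  ∫ w, starRingEnd ℂ (P.eval w) * Q.eval w ∂μ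

/-- The monic orthogonal polynomial `Φ_n(· ; μ)`, by (unnormalized) Gram-Schmidt orthogonalization
of `1, X, X², …` with respect to `polyInner μ`. It is used for finite measures whose support is
bounded and infinite, so that no denominator vanishes. -/
def monicOP (μ : Measure ℂ) (n : ℕ) : ℂ[X] :=
  X ^ n - ∑ j : Fin n,
    C (polyInner μ (monicOP μ j.1) (X ^ n) / polyInner μ (monicOP μ j.1) (monicOP μ j.1)) *
      monicOP μ j.1
termination_by n
decreasing_by all_goals exact j.2

/-- For a polynomial `P` of degree at most `m`, the polynomial
`z ↦ z ^ m * conj (P (1 / conj z))`: conjugate the coefficients and reverse their order. -/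
def starReverse (m : ℕ) (P : ℂ[X]) : ℂ[X] :=
  (P.map (starRingEnd ℂ)).reflect m

/-- The paraorthogonal polynomial of degree `n` (for `n ≥ 1`):
`Φ_n^{(-1)}(z) = z Φ_{n-1}(z) + z ^ (n-1) * conj (Φ_{n-1}(1 / conj z))`. -/
def paraOP (μ : Measure ℂ) (n : ℕ) : ℂ[X] :=
  X * monicOP μ (n - 1) + starReverse (n - 1) (monicOP μ (n - 1))

/-- `μ` is a probability measure on `ℂ` whose support is contained in the unit circle. -/
def IsCircleProbability (μ : Measure ℂ) : Prop :=
  IsProbabilityMeasure μ ∧ μ.support ⊆ Metric.sphere (0 : ℂ) 1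

/-- `Φ_{n-1}(z; μ) / Φ_n^{(-1)}(z; μ) → f z` for every `|z| > 1`, as `n` runs through the
strictly increasing sequence `N 0 < N 1 < …`. -/
def RatioTendsto (μ : Measure ℂ) (N : ℕ → ℕ) (f : ℂ → ℂ) : Prop :=
  ∀ z : ℂ, 1 < ‖z‖ →
    Tendsto (fun k => (monicOP μ (N k - 1)).eval z / (paraOP μ (N k)).eval z) atTop (𝓝 (f z))

/-- `f z = ∫ 1 / (z - w) dν(w)` for every `|z| > 1`. -/
def IsCauchyTransform (ν : Measure ℂ) (f : ℂ → ℂ) : Prop :=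
  ∀ z : ℂ, 1 < ‖z‖ → f z = ∫ w, 1 / (z - w) ∂ν

end CirclePolynomials

end

/-!
Write `Φₙ` for the monic orthogonal polynomials of `μ` and `Φₙ*` for their reversals. For `‖z‖ > 1`,
the ratio `Φₙ(z) / (z Φₙ(z) + Φₙ*(z))` is `u / (1 + u sₙ(u))` with `u = z⁻¹` and
`sₙ(u) = Φₙ*(z) / Φₙ(z)`. By the Szegő recursion the `sₙ` are the iterates, starting from `1`, of
the inverse Schur algorithm driven by the Verblunsky coefficients of `μ`, so they are Schur
functions. By the Riesz-Herglotz theorem the functions `1 / (1 + u g(u))` with `g` Schur are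
exactly the functions `∫ (1 - u w)⁻¹ dν(w)` with `ν` a probability measure on the circle. Hence each
ratio is a Cauchy transform of such a measure, and weak compactness passes to the limit.

Conversely, let the Cauchy transform of `ν` correspond to the Schur function `g`. Choose the
Verblunsky coefficients in blocks ending at sparse indices, the block of length `m` being the
reversed list of the first `m` Schur parameters of `r g`, with `r < 1` tending to `1`. By the
Schwarz lemma the influence of what precedes a block of length `m` is `O(‖u‖ ^ m)`, so the iterates
at the ends of the blocks tend to `g`. Verblunsky's theorem provides `μ`.
-/

open scoped ComplexConjugate

noncomputable section

namespace CirclePolynomials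

/-! ### Probability measures on the unit circle -/

section CircleMeasures

variable {μ : Measure ℂ}

theorem IsCircleProbability.ae_norm_eq_one (h : IsCircleProbability μ) : ∀ᵐ w ∂μ, ‖w‖ = 1 :=
  mem_of_superset Measure.support_mem_ae fun _ hw => mem_sphere_zero_iff_norm.1 (h.2 hw)

theorem IsCircleProbability.of_ae_norm_eq_one [IsProbabilityMeasure μ]
    (h : ∀ᵐ w ∂μ, ‖w‖ = 1) : IsCircleProbability μ :=
  ⟨inferInstance, Measure.support_subset_of_isClosed Metric.isClosed_sphere
    (h.mono fun _ hw => mem_sphere_zero_iff_norm.2 hw)⟩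

theorem IsCircleProbability.integrable {E : Type*} [NormedAddCommGroup E]
    (h : IsCircleProbability μ) {g : ℂ → E} (hg : ContinuousOn g (Metric.sphere 0 1)) :
    Integrable g μ := by
  have := h.1
  have hon : IntegrableOn g (Metric.sphere 0 1) μ := hg.integrableOn_compact (isCompact_sphere 0 1)
  rwa [IntegrableOn, Measure.restrict_eq_self_of_ae_mem
    (h.ae_norm_eq_one.mono fun _ hw => mem_sphere_zero_iff_norm.2 hw)] at hon

theorem IsCircleProbability.integral_congr {E : Type*} [NormedAddCommGroup E] [NormedSpace ℝ E]
    (h : IsCircleProbability μ) {f g : ℂ → E} (hfg : ∀ w, ‖w‖ = 1 → f w = g w) :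
    ∫ w, f w ∂μ = ∫ w, g w ∂μ :=
  integral_congr_ae (h.ae_norm_eq_one.mono hfg)

/-- The normalized arc length measure on the unit circle, as a measure on `ℂ`. -/
def uniformCircle : Measure ℂ :=
  (ProbabilityTheory.cond volume (Set.Ioc 0 (2 * Real.pi))).map (circleMap 0 1)

theorem isCircleProbability_uniformCircle : IsCircleProbability uniformCircle := by
  have hmeas : AEMeasurable (circleMap 0 1)
      (ProbabilityTheory.cond volume (Set.Ioc 0 (2 * Real.pi))) :=
    (continuous_circleMap 0 1).aemeasurable
  have : IsProbabilityMeasure (ProbabilityTheory.cond volume (Set.Ioc 0 (2 * Real.pi))) :=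
    ProbabilityTheory.cond_isProbabilityMeasure_of_finite (by simp [Real.pi_pos])
      measure_Ioc_lt_top.ne
  have : IsProbabilityMeasure uniformCircle := Measure.isProbabilityMeasure_map hmeas
  exact .of_ae_norm_eq_one ((ae_map_iff hmeas (isClosed_eq continuous_norm
    continuous_const).measurableSet).2 (Eventually.of_forall fun θ => by simp))

theorem integral_uniformCircle {E : Type*} [NormedAddCommGroup E] [NormedSpace ℝ E] {g : ℂ → E}
    (hg : ContinuousOn g (Metric.sphere 0 1)) :
    ∫ w, g w ∂uniformCircle = Real.circleAverage g 0 1 := by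
  have hmeas := (isCircleProbability_uniformCircle.integrable hg).aestronglyMeasurable
  rw [uniformCircle] at hmeas ⊢
  rw [integral_map (continuous_circleMap 0 1).aemeasurable hmeas, ProbabilityTheory.cond,
    integral_smul_measure, Real.circleAverage_def,
    intervalIntegral.integral_of_le Real.two_pi_pos.le]
  simp [ENNReal.toReal_ofReal Real.pi_pos.le]

theorem isCircleProbability_withDensity {D : ℂ → ℝ} (hD : ContinuousOn D (Metric.sphere 0 1))
    (hpos : ∀ w, ‖w‖ = 1 → 0 ≤ D w) (hone : Real.circleAverage D 0 1 = 1) :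
    IsCircleProbability (uniformCircle.withDensity fun w => ENNReal.ofReal (D w)) := by
  have hmass : ∫⁻ w, ENNReal.ofReal (D w) ∂uniformCircle = 1 := by
    rw [← ofReal_integral_eq_lintegral_ofReal (isCircleProbability_uniformCircle.integrable hD)
      (isCircleProbability_uniformCircle.ae_norm_eq_one.mono hpos), integral_uniformCircle hD, hone,
      ENNReal.ofReal_one]
  have : IsProbabilityMeasure (uniformCircle.withDensity fun w => ENNReal.ofReal (D w)) :=
    ⟨by rw [withDensity_apply _ .univ, setLIntegral_univ, hmass]⟩
  exact .of_ae_norm_eq_one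
    ((withDensity_absolutelyContinuous _ _).ae_le isCircleProbability_uniformCircle.ae_norm_eq_one)

theorem integral_uniformCircle_withDensity {E : Type*} [NormedAddCommGroup E] [NormedSpace ℝ E]
    {D : ℂ → ℝ} (hD : ContinuousOn D (Metric.sphere 0 1)) (hpos : ∀ w, ‖w‖ = 1 → 0 ≤ D w)
    {g : ℂ → E} (hg : ContinuousOn g (Metric.sphere 0 1)) :
    ∫ w, g w ∂(uniformCircle.withDensity fun w => ENNReal.ofReal (D w)) =
      Real.circleAverage (fun w => D w • g w) 0 1 := by
  rw [integral_withDensity_eq_integral_toReal_smul₀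
    (isCircleProbability_uniformCircle.integrable hD).aemeasurable.ennreal_ofReal
    (Eventually.of_forall fun _ => ENNReal.ofReal_lt_top),
    isCircleProbability_uniformCircle.integral_congr fun w hw => by
      rw [ENNReal.toReal_ofReal (hpos w hw)]]
  exact integral_uniformCircle (hD.smul hg)

theorem circleAverage_pos {D : ℂ → ℝ} (hD : ContinuousOn D (Metric.sphere 0 1))
    (hpos : ∀ w, ‖w‖ = 1 → 0 < D w) : 0 < Real.circleAverage D 0 1 := by
  obtain ⟨w₀, hw₀, hmin⟩ := (isCompact_sphere (0 : ℂ) 1).exists_isMinOn ⟨1, by simp⟩ hD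
  refine (hpos w₀ (mem_sphere_zero_iff_norm.1 hw₀)).trans_le ?_
  rw [← Real.circleAverage_const (D w₀) 0 1]
  exact Real.circleAverage_mono (continuousOn_const.circleIntegrable zero_le_one)
    (hD.circleIntegrable zero_le_one) fun w hw => hmin (by rwa [abs_one] at hw)

theorem exists_integral_eq_smul_circleAverage {D : ℂ → ℝ}
    (hD : ContinuousOn D (Metric.sphere 0 1)) (hpos : ∀ w, ‖w‖ = 1 → 0 < D w) :
    ∃ μ, IsCircleProbability μ ∧ ∃ c : ℝ, ∀ g : ℂ → ℂ, ContinuousOn g (Metric.sphere 0 1) →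
      ∫ w, g w ∂μ = c • Real.circleAverage (fun w => D w • g w) 0 1 := by
  have hc := circleAverage_pos hD hpos
  set c := Real.circleAverage D 0 1 with hc_def
  have hDc : ContinuousOn (fun w => c⁻¹ • D w) (Metric.sphere 0 1) := hD.const_smul c⁻¹
  have hDc_nonneg (w : ℂ) (hw : ‖w‖ = 1) : 0 ≤ c⁻¹ • D w :=
    smul_nonneg (inv_nonneg.2 hc.le) (hpos w hw).le
  refine ⟨_, isCircleProbability_withDensity hDc hDc_nonneg ?_, c⁻¹, fun g hg => ?_⟩
  · rw [Real.circleAverage_fun_smul, ← hc_def, smul_eq_mul, inv_mul_cancel₀ hc.ne']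
  · rw [integral_uniformCircle_withDensity hDc hDc_nonneg hg, ← Real.circleAverage_fun_smul]
    simp only [smul_assoc]

theorem isCircleProbability_map_coe (p : ProbabilityMeasure (Metric.sphere (0 : ℂ) 1)) :
    IsCircleProbability ((p : Measure (Metric.sphere (0 : ℂ) 1)).map (↑)) := by
  have hmeas : AEMeasurable ((↑) : Metric.sphere (0 : ℂ) 1 → ℂ)
      (p : Measure (Metric.sphere (0 : ℂ) 1)) := measurable_subtype_coe.aemeasurable
  have := Measure.isProbabilityMeasure_map hmeas
  exact .of_ae_norm_eq_one ((ae_map_iff hmeas (isClosed_eq continuous_norm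
    continuous_const).measurableSet).2
    (Eventually.of_forall fun x => mem_sphere_zero_iff_norm.1 x.2))

theorem IsCircleProbability.exists_map_coe_eq (h : IsCircleProbability μ) :
    ∃ p : ProbabilityMeasure (Metric.sphere (0 : ℂ) 1),
      (p : Measure (Metric.sphere (0 : ℂ) 1)).map (↑) = μ := by
  have hemb : MeasurableEmbedding ((↑) : Metric.sphere (0 : ℂ) 1 → ℂ) :=
    .subtype_coe Metric.isClosed_sphere.measurableSet
  have hmap : (μ.comap ((↑) : Metric.sphere (0 : ℂ) 1 → ℂ)).map (↑) = μ := by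
    rw [hemb.map_comap, Subtype.range_coe]
    exact Measure.restrict_eq_self_of_ae_mem
      (h.ae_norm_eq_one.mono fun _ hw => mem_sphere_zero_iff_norm.2 hw)
  have hprob : IsProbabilityMeasure (μ.comap ((↑) : Metric.sphere (0 : ℂ) 1 → ℂ)) := by
    rw [← Measure.isProbabilityMeasure_map_iff hemb.measurable.aemeasurable, hmap]
    exact h.1
  exact ⟨⟨_, hprob⟩, hmap⟩

theorem exists_tendsto_integral_of_ultrafilter {ι : Type*} (l : Ultrafilter ι) {μ : ι → Measure ℂ}
    (hμ : ∀ i, IsCircleProbability (μ i)) :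
    ∃ ν : Measure ℂ, IsCircleProbability ν ∧ ∀ g : ℂ → ℂ, ContinuousOn g (Metric.sphere 0 1) →
      Tendsto (fun i => ∫ w, g w ∂(μ i)) l (𝓝 (∫ w, g w ∂ν)) := by
  choose p hp using fun i => (hμ i).exists_map_coe_eq
  obtain ⟨q, -, hq⟩ := isCompact_univ.ultrafilter_le_nhds (l.map p) (by simp)
  have hlim : Tendsto p l (𝓝 q) := hq
  refine ⟨_, isCircleProbability_map_coe q, fun g hg => ?_⟩
  have hemb : MeasurableEmbedding ((↑) : Metric.sphere (0 : ℂ) 1 → ℂ) :=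
    .subtype_coe Metric.isClosed_sphere.measurableSet
  simp only [← hp, hemb.integral_map]
  exact (ProbabilityMeasure.tendsto_iff_forall_integral_rclike_tendsto ℂ).1 hlim
    (.mkOfCompact ⟨fun x => g x, continuousOn_iff_continuous_domRestrict.1 hg⟩)

theorem exists_eq_integral_of_tendsto {ι κ : Type*} {l : Filter ι} [l.NeBot] {μ : ι → Measure ℂ}
    (hμ : ∀ i, IsCircleProbability (μ i)) {s : Set κ} {k : κ → ℂ → ℂ} {F : κ → ℂ}
    (hk : ∀ x ∈ s, ContinuousOn (k x) (Metric.sphere 0 1))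
    (hF : ∀ x ∈ s, Tendsto (fun i => ∫ w, k x w ∂(μ i)) l (𝓝 (F x))) :
    ∃ ν, IsCircleProbability ν ∧ ∀ x ∈ s, F x = ∫ w, k x w ∂ν := by
  obtain ⟨ν, hν, hlim⟩ := exists_tendsto_integral_of_ultrafilter (.of l) hμ
  exact ⟨ν, hν, fun x hx =>
    tendsto_nhds_unique ((hF x hx).mono_left (Ultrafilter.of_le l)) (hlim _ (hk x hx))⟩

end CircleMeasures

/-! ### The Riesz-Herglotz theorem in the unit disc -/

section Herglotz

variable {ν : Measure ℂ} {u v w : ℂ}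

theorem norm_mul_lt_one (hu : ‖u‖ < 1) (hw : ‖w‖ ≤ 1) : ‖u * w‖ < 1 := by
  rw [norm_mul]
  exact mul_lt_one_of_nonneg_of_lt_one_left (norm_nonneg u) hu hw

theorem one_sub_mul_ne_zero (hu : ‖u‖ < 1) (hw : ‖w‖ ≤ 1) : 1 - u * w ≠ 0 := by
  intro h
  have hlt := norm_mul_lt_one hu hw
  rw [← sub_eq_zero.1 h, norm_one] at hlt
  exact lt_irrefl 1 hlt

theorem one_add_mul_ne_zero (hu : ‖u‖ < 1) (hw : ‖w‖ ≤ 1) : 1 + u * w ≠ 0 := by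
  simpa using one_sub_mul_ne_zero hu (w := -w) (by simpa using hw)

theorem half_le_re_inv_one_add_iff (hv : 1 + v ≠ 0) : 1 / 2 ≤ ((1 + v)⁻¹).re ↔ ‖v‖ ≤ 1 := by
  rw [← sq_le_one_iff₀ (norm_nonneg v), ← Complex.normSq_eq_norm_sq, Complex.inv_re,
    div_le_div_iff₀ two_pos (Complex.normSq_pos.2 hv), Complex.normSq_apply, Complex.normSq_apply]
  simp only [Complex.add_re, Complex.add_im, Complex.one_re, Complex.one_im]
  constructor <;> intro h <;> linarith

theorem continuousOn_inv_one_sub_mul (hu : ‖u‖ < 1) :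
    ContinuousOn (fun w : ℂ => (1 - u * w)⁻¹) (Metric.sphere 0 1) :=
  ContinuousOn.inv₀ (by fun_prop) fun _ hw =>
    one_sub_mul_ne_zero hu (mem_sphere_zero_iff_norm.1 hw).le

/-- The generating function `∑ uⁿ ∫ wⁿ dν(w)` of the moments of `ν`, in closed form. Its values in
the unit disc are those of the Cauchy transform of `ν` outside the disc: see
`integral_one_div_sub`. -/
def discTransform (ν : Measure ℂ) (u : ℂ) : ℂ := ∫ w, (1 - u * w)⁻¹ ∂ν

theorem integral_one_div_sub (ν : Measure ℂ) {z : ℂ} (hz : z ≠ 0) :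
    ∫ w, 1 / (z - w) ∂ν = z⁻¹ * discTransform ν z⁻¹ := by
  rw [discTransform, ← integral_const_mul]
  refine integral_congr_ae (Eventually.of_forall fun w => ?_)
  dsimp only
  rw [← mul_inv, mul_sub, mul_one, mul_inv_cancel_left₀ hz, one_div]

theorem discTransform_zero (hν : IsCircleProbability ν) : discTransform ν 0 = 1 := by
  have := hν.1
  simp [discTransform]

theorem half_le_re_discTransform (hν : IsCircleProbability ν) (hu : ‖u‖ < 1) :
    1 / 2 ≤ (discTransform ν u).re := by
  have := hν.1
  have hint := hν.integrable (continuousOn_inv_one_sub_mul hu)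
  calc (1 / 2 : ℝ) = ∫ _, (1 / 2 : ℝ) ∂ν := by simp
    _ ≤ ∫ w, ((1 - u * w)⁻¹).re ∂ν := by
      refine integral_mono_ae (integrable_const _) hint.re (hν.ae_norm_eq_one.mono fun w hw => ?_)
      have hne := one_sub_mul_ne_zero hu hw.le
      rw [sub_eq_add_neg] at hne
      simpa only [sub_eq_add_neg] using (half_le_re_inv_one_add_iff hne).2
        (by simpa only [norm_neg] using (norm_mul_lt_one hu hw.le).le)
    _ = (discTransform ν u).re := integral_re hint

theorem differentiableOn_discTransform (hν : IsCircleProbability ν) :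
    DifferentiableOn ℂ (discTransform ν) (Metric.ball 0 1) := by
  intro u₀ hu₀
  have := hν.1
  rw [mem_ball_zero_iff] at hu₀
  obtain ⟨r, hur, hr⟩ := exists_between hu₀
  have hbound {u w : ℂ} (hu : u ∈ Metric.ball 0 r) (hw : ‖w‖ = 1) : 1 - r ≤ ‖1 - u * w‖ := by
    have h := norm_sub_norm_le (1 : ℂ) (u * w)
    rw [norm_one, norm_mul, hw, mul_one] at h
    linarith [mem_ball_zero_iff.1 hu]
  have hdisc {u : ℂ} (hu : u ∈ Metric.ball 0 r) : ‖u‖ < 1 := (mem_ball_zero_iff.1 hu).trans hr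
  refine (hasDerivAt_integral_of_dominated_loc_of_deriv_le
    (F' := fun u w => w / (1 - u * w) ^ 2) (bound := fun _ => 1 / (1 - r) ^ 2)
    (Metric.isOpen_ball.mem_nhds (mem_ball_zero_iff.2 hur)) ?_
    (hν.integrable (continuousOn_inv_one_sub_mul hu₀)) ?_ ?_
    (integrable_const _) ?_).2.differentiableAt.differentiableWithinAt
  · filter_upwards [Metric.isOpen_ball.mem_nhds (mem_ball_zero_iff.2 hur)] with u hu
    exact (hν.integrable (continuousOn_inv_one_sub_mul (hdisc hu))).aestronglyMeasurable
  · exact (hν.integrable (ContinuousOn.div (by fun_prop) (by fun_prop) fun w hw => pow_ne_zero 2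
      (one_sub_mul_ne_zero hu₀ (mem_sphere_zero_iff_norm.1 hw).le))).aestronglyMeasurable
  · filter_upwards [hν.ae_norm_eq_one] with w hw u hu
    rw [norm_div, norm_pow, hw]
    have : 0 < 1 - r := sub_pos.2 hr
    gcongr
    exact hbound hu hw
  · filter_upwards [hν.ae_norm_eq_one] with w hw u hu
    have hden : HasDerivAt (fun u : ℂ => 1 - u * w) (-w) u := by
      simpa using ((hasDerivAt_id u).mul_const w).const_sub 1
    exact (hden.inv (one_sub_mul_ne_zero (hdisc hu) hw.le)).congr_deriv (by rw [neg_neg])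

theorem continuousOn_comp_inv {g : ℂ → ℂ} (hg : ContinuousOn g (Metric.sphere 0 1)) :
    ContinuousOn (fun w => g w⁻¹) (Metric.sphere 0 1) := by
  refine hg.comp (continuousOn_inv₀.mono fun w hw => ?_) fun w hw => ?_
  · exact ne_of_mem_of_not_mem hw (by simp)
  · simpa using hw

theorem circleAverage_inv_one_sub_mul {G : ℂ → ℂ} (hG : DiffContOnCl ℂ G (Metric.ball 0 1))
    (hu : ‖u‖ < 1) : Real.circleAverage (fun w => (1 - u * w⁻¹)⁻¹ * G w) 0 1 = G u := by
  rw [← DiffContOnCl.circleAverage_smul_div (f := G) (c := 0) (R := 1) (by simpa using hG)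
    (by simpa using hu)]
  refine Real.circleAverage_congr_sphere fun w hw => ?_
  have hw1 : ‖w‖ = 1 := by simpa using hw
  have hw0 : w ≠ 0 := norm_ne_zero_iff.1 (by simp [hw1])
  simp only [sub_zero, smul_eq_mul]
  rw [← inv_div, sub_div, div_self hw0, div_eq_mul_inv u]

theorem circleAverage_inv_one_sub_mul_conj {G : ℂ → ℂ} (hG : DiffContOnCl ℂ G (Metric.ball 0 1))
    (hu : ‖u‖ < 1) :
    Real.circleAverage (fun w => (1 - u * w⁻¹)⁻¹ * conj (G w)) 0 1 = conj (G 0) := by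
  have hH : DiffContOnCl ℂ (fun w => (1 - conj u * w)⁻¹ * G w) (Metric.ball 0 1) := by
    refine DiffContOnCl.smul (DiffContOnCl.inv (Differentiable.diffContOnCl
      (by fun_prop : Differentiable ℂ fun w => 1 - conj u * w)) fun w hw => ?_) hG
    rw [closure_ball (0 : ℂ) one_ne_zero, mem_closedBall_zero_iff] at hw
    exact one_sub_mul_ne_zero (by rwa [RCLike.norm_conj]) hw
  have hHc : CircleIntegrable (fun w => (1 - conj u * w)⁻¹ * G w) 0 1 :=
    (hH.continuousOn_ball.mono Metric.sphere_subset_closedBall).circleIntegrable zero_le_one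
  have hmean : Real.circleAverage (fun w => (1 - conj u * w)⁻¹ * G w) 0 1 = G 0 := by
    rw [DiffContOnCl.circleAverage (by rwa [abs_one])]
    simp
  rw [← hmean]
  refine Eq.trans (Real.circleAverage_congr_sphere fun w hw => ?_)
    ((Complex.conjCLE : ℂ →L[ℝ] ℂ).circleAverage_comp_comm hHc)
  have hw1 : ‖w‖ = 1 := by simpa using hw
  simp [Complex.inv_eq_conj hw1]

theorem circleAverage_poisson {G : ℂ → ℂ} (hG : DiffContOnCl ℂ G (Metric.ball 0 1))
    (hu : ‖u‖ < 1) :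
    Real.circleAverage (fun w => (2 * (G w).re - 1) • (1 - u * w⁻¹)⁻¹) 0 1 =
      G u + conj (G 0) - 1 := by
  have hGs := hG.continuousOn_ball.mono Metric.sphere_subset_closedBall
  have hk := continuousOn_comp_inv (continuousOn_inv_one_sub_mul hu)
  have hint {g : ℂ → ℂ} (hg : ContinuousOn g (Metric.sphere 0 1)) :
      CircleIntegrable (fun w => (1 - u * w⁻¹)⁻¹ * g w) 0 1 :=
    (hk.mul hg).circleIntegrable zero_le_one
  have hG_int := hint hGs
  have hconj_int := hint (g := fun w => conj (G w))
    (Complex.continuous_conj.comp_continuousOn hGs)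
  have hsplit (w : ℂ) : (2 * (G w).re - 1) • (1 - u * w⁻¹)⁻¹ = (1 - u * w⁻¹)⁻¹ * G w +
      (1 - u * w⁻¹)⁻¹ * conj (G w) - (1 - u * w⁻¹)⁻¹ * 1 := by
    rw [← mul_add, Complex.add_conj, Complex.real_smul]
    push_cast
    ring
  calc Real.circleAverage (fun w => (2 * (G w).re - 1) • (1 - u * w⁻¹)⁻¹) 0 1
    _ = Real.circleAverage (fun w => (1 - u * w⁻¹)⁻¹ * G w) 0 1 +
          Real.circleAverage (fun w => (1 - u * w⁻¹)⁻¹ * conj (G w)) 0 1 -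
          Real.circleAverage (fun w => (1 - u * w⁻¹)⁻¹ * 1) 0 1 := by
      simp only [hsplit]
      rw [← Real.circleAverage_fun_add hG_int hconj_int]
      exact Real.circleAverage_fun_sub (hG_int.add hconj_int) (hint continuousOn_const)
    _ = G u + conj (G 0) - 1 := by
      rw [circleAverage_inv_one_sub_mul hG hu, circleAverage_inv_one_sub_mul_conj hG hu,
        circleAverage_inv_one_sub_mul (G := fun _ => 1) diffContOnCl_const hu]

theorem circleAverage_two_mul_re_sub_one {G : ℂ → ℂ} (hG : DiffContOnCl ℂ G (Metric.ball 0 1)) :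
    Real.circleAverage (fun w => 2 * (G w).re - 1) 0 1 = 2 * (G 0).re - 1 := by
  have hH : DiffContOnCl ℂ (fun w => 2 * G w - 1) (Metric.ball 0 1) :=
    (hG.const_smul (2 : ℂ)).sub_const 1
  have hHc : CircleIntegrable (fun w => 2 * G w - 1) 0 1 :=
    (hH.continuousOn_ball.mono Metric.sphere_subset_closedBall).circleIntegrable zero_le_one
  have hcomm := Complex.reCLM.circleAverage_comp_comm hHc
  rw [DiffContOnCl.circleAverage (R := 1) (by rwa [abs_one])] at hcomm
  simpa [Function.comp_def] using hcomm

theorem exists_discTransform_eq_of_diffContOnCl {G : ℂ → ℂ}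
    (hG : DiffContOnCl ℂ G (Metric.ball 0 1)) (hG0 : G 0 = 1)
    (hre : ∀ w, ‖w‖ = 1 → 1 / 2 ≤ (G w).re) :
    ∃ ν, IsCircleProbability ν ∧ ∀ u, ‖u‖ < 1 → discTransform ν u = G u := by
  have hD : ContinuousOn (fun w => 2 * (G w⁻¹).re - 1) (Metric.sphere 0 1) := by
    have hinv := continuousOn_comp_inv (hG.continuousOn_ball.mono Metric.sphere_subset_closedBall)
    exact (continuousOn_const.mul (Complex.continuous_re.comp_continuousOn hinv)).sub
      continuousOn_const
  have hpos (w : ℂ) (hw : ‖w‖ = 1) : 0 ≤ 2 * (G w⁻¹).re - 1 := by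
    linarith [hre w⁻¹ (by simp [hw])]
  refine ⟨_, isCircleProbability_withDensity hD hpos ?_, fun u hu => ?_⟩
  · rw [Real.circleAverage_zero_one_congr_inv (f := fun w => 2 * (G w).re - 1),
      circleAverage_two_mul_re_sub_one hG, hG0]
    norm_num
  · rw [discTransform, integral_uniformCircle_withDensity hD hpos (continuousOn_inv_one_sub_mul hu),
      ← Real.circleAverage_zero_one_congr_inv]
    simp only [inv_inv]
    rw [circleAverage_poisson hG hu, hG0, map_one, add_sub_cancel_right]

theorem norm_natCast_div_add_one_mul_lt (n : ℕ) (hu : ‖u‖ ≤ 1) :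
    ‖(n / (n + 1) : ℂ) * u‖ < 1 := by
  refine norm_mul_lt_one ?_ hu
  rw [norm_div, ← Nat.cast_add_one, Complex.norm_natCast, Complex.norm_natCast,
    div_lt_one (by positivity)]
  exact_mod_cast n.lt_succ_self

theorem tendsto_comp_natCast_div_add_one_mul {F : ℂ → ℂ}
    (hF : DifferentiableOn ℂ F (Metric.ball 0 1)) (hu : ‖u‖ < 1) :
    Tendsto (fun n : ℕ => F ((n / (n + 1)) * u)) atTop (𝓝 (F u)) := by
  refine (hF.continuousOn.continuousAt
    (Metric.isOpen_ball.mem_nhds (by simpa using hu))).tendsto.comp ?_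
  simpa using (tendsto_natCast_div_add_atTop (1 : ℂ)).mul_const u

theorem exists_discTransform_eq {F : ℂ → ℂ} (hF : DifferentiableOn ℂ F (Metric.ball 0 1))
    (hF0 : F 0 = 1) (hre : ∀ u, ‖u‖ < 1 → 1 / 2 ≤ (F u).re) :
    ∃ ν, IsCircleProbability ν ∧ ∀ u, ‖u‖ < 1 → discTransform ν u = F u := by
  have hdilate (n : ℕ) : DiffContOnCl ℂ (fun u => F ((n / (n + 1)) * u)) (Metric.ball 0 1) := by
    refine DifferentiableOn.diffContOnCl (hF.comp (by fun_prop) fun u hu => ?_)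
    rw [closure_ball (0 : ℂ) one_ne_zero, mem_closedBall_zero_iff] at hu
    exact mem_ball_zero_iff.2 (norm_natCast_div_add_one_mul_lt n hu)
  choose μ hμ hμF using fun n => exists_discTransform_eq_of_diffContOnCl (hdilate n)
    (by simp [hF0]) fun w hw => hre _ (norm_natCast_div_add_one_mul_lt n hw.le)
  obtain ⟨ν, hν, hFν⟩ := exists_eq_integral_of_tendsto (l := atTop) hμ
    (s := Metric.ball 0 1) (k := fun u w => (1 - u * w)⁻¹) (F := F)
    (fun u hu => continuousOn_inv_one_sub_mul (mem_ball_zero_iff.1 hu)) fun u hu => by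
      rw [mem_ball_zero_iff] at hu
      exact (tendsto_comp_natCast_div_add_one_mul hF hu).congr fun n => (hμF n u hu).symm
  exact ⟨ν, hν, fun u hu => (hFν u (mem_ball_zero_iff.2 hu)).symm⟩

end Herglotz

/-! ### Schur functions -/

/-- `g` is holomorphic in the open unit disc and bounded there by `s`. The Schur functions are those
with `s = 1`; a value `s < 1` keeps `g` away from the unit circle. -/
structure IsSchur (s : ℝ) (g : ℂ → ℂ) : Prop where
  differentiableOn : DifferentiableOn ℂ g (Metric.ball 0 1)
  norm_le : ∀ u, ‖u‖ < 1 → ‖g u‖ ≤ s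

namespace IsSchur

variable {s t : ℝ} {g : ℂ → ℂ}

theorem mono (hg : IsSchur s g) (hst : s ≤ t) : IsSchur t g :=
  ⟨hg.differentiableOn, fun u hu => (hg.norm_le u hu).trans hst⟩

theorem id_mul (hg : IsSchur s g) : IsSchur s fun u => u * g u :=
  ⟨differentiableOn_id.mul hg.differentiableOn, fun u hu => by
    rw [norm_mul]
    exact (mul_le_of_le_one_left (norm_nonneg _) hu.le).trans (hg.norm_le u hu)⟩

theorem dslope_zero (hg : IsSchur s g) (hg0 : g 0 = 0) : IsSchur s (dslope g 0) := by
  refine ⟨(Complex.differentiableOn_dslope (Metric.ball_mem_nhds _ one_pos)).2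
    hg.differentiableOn, fun u hu => ?_⟩
  have hmaps : Set.MapsTo g (Metric.ball 0 1) (Metric.closedBall (g 0) s) := fun u hu => by
    simpa [hg0] using hg.norm_le u (mem_ball_zero_iff.1 hu)
  simpa using Complex.norm_dslope_le_div_of_mapsTo_ball hg.differentiableOn hmaps
    (mem_ball_zero_iff.2 hu)

end IsSchur

theorem mul_dslope_zero {g : ℂ → ℂ} (hg0 : g 0 = 0) (u : ℂ) : u * dslope g 0 u = g u := by
  simpa [hg0] using sub_smul_dslope g 0 u

theorem exists_discTransform_eq_inv {g : ℂ → ℂ} (hg : IsSchur 1 g) :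
    ∃ ν, IsCircleProbability ν ∧ ∀ u, ‖u‖ < 1 → discTransform ν u = (1 + u * g u)⁻¹ := by
  have hne (u : ℂ) (hu : ‖u‖ < 1) := one_add_mul_ne_zero hu (hg.norm_le u hu)
  refine exists_discTransform_eq
    ((hg.id_mul.differentiableOn.const_add 1).inv fun u hu => hne u (mem_ball_zero_iff.1 hu))
    (by simp) fun u hu => ?_
  exact (half_le_re_inv_one_add_iff (hne u hu)).2 (norm_mul_lt_one hu (hg.norm_le u hu)).le

theorem exists_isSchur_discTransform_eq_inv {ν : Measure ℂ} (hν : IsCircleProbability ν) :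
    ∃ g, IsSchur 1 g ∧ ∀ u, ‖u‖ < 1 → discTransform ν u = (1 + u * g u)⁻¹ := by
  have hne (u : ℂ) (hu : ‖u‖ < 1) : discTransform ν u ≠ 0 := fun h => by
    have hre := half_le_re_discTransform hν hu
    rw [h, Complex.zero_re] at hre
    linarith
  let φ : ℂ → ℂ := fun u => (discTransform ν u)⁻¹ - 1
  have hφ0 : φ 0 = 0 := by simp [φ, discTransform_zero hν]
  have hφ : IsSchur 1 φ := by
    refine ⟨((differentiableOn_discTransform hν).inv fun u hu =>
      hne u (mem_ball_zero_iff.1 hu)).sub_const 1, fun u hu => ?_⟩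
    have hφu : 1 + φ u = (discTransform ν u)⁻¹ := add_sub_cancel _ _
    have hφu0 : 1 + φ u ≠ 0 := hφu ▸ inv_ne_zero (hne u hu)
    refine (half_le_re_inv_one_add_iff hφu0).1 ?_
    rw [hφu, inv_inv]
    exact half_le_re_discTransform hν hu
  refine ⟨dslope φ 0, hφ.dslope_zero hφ0, fun u _ => ?_⟩
  rw [mul_dslope_zero hφ0, add_sub_cancel, inv_inv]

/-! ### The Schur algorithm -/

/-- The disc automorphism `x ↦ (x - a) / (1 - conj a * x)`, for `‖a‖ < 1`. -/
def blaschke (a x : ℂ) : ℂ := (x - a) / (1 - conj a * x)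

section Blaschke

variable {a x y : ℂ}

theorem blaschke_denom_ne_zero (ha : ‖a‖ < 1) (hx : ‖x‖ ≤ 1) : 1 - conj a * x ≠ 0 :=
  one_sub_mul_ne_zero (by rwa [RCLike.norm_conj]) hx

theorem normSq_blaschke_denom_sub (a x : ℂ) :
    Complex.normSq (1 - conj a * x) - Complex.normSq (x - a) =
      (1 - Complex.normSq a) * (1 - Complex.normSq x) := by
  simp only [Complex.normSq_apply, Complex.sub_re, Complex.sub_im, Complex.mul_re, Complex.mul_im,
    Complex.one_re, Complex.one_im, Complex.conj_re, Complex.conj_im]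
  ring

theorem norm_blaschke_le_one (ha : ‖a‖ < 1) (hx : ‖x‖ ≤ 1) : ‖blaschke a x‖ ≤ 1 := by
  have hden := blaschke_denom_ne_zero ha hx
  rw [blaschke, norm_div, div_le_one (norm_pos_iff.2 hden), Complex.norm_def, Complex.norm_def]
  refine Real.sqrt_le_sqrt (sub_nonneg.1 ?_)
  rw [normSq_blaschke_denom_sub, Complex.normSq_eq_norm_sq, Complex.normSq_eq_norm_sq]
  exact mul_nonneg (sub_nonneg.2 (pow_le_one₀ (norm_nonneg a) ha.le))
    (sub_nonneg.2 (pow_le_one₀ (norm_nonneg x) hx))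

theorem norm_blaschke_lt_one (ha : ‖a‖ < 1) (hx : ‖x‖ < 1) : ‖blaschke a x‖ < 1 := by
  have hden := blaschke_denom_ne_zero ha hx.le
  rw [blaschke, norm_div, div_lt_one (norm_pos_iff.2 hden), Complex.norm_def, Complex.norm_def]
  refine Real.sqrt_lt_sqrt (Complex.normSq_nonneg _) (sub_pos.1 ?_)
  rw [normSq_blaschke_denom_sub, Complex.normSq_eq_norm_sq, Complex.normSq_eq_norm_sq]
  exact mul_pos (sub_pos.2 (pow_lt_one₀ (norm_nonneg a) ha two_ne_zero))
    (sub_pos.2 (pow_lt_one₀ (norm_nonneg x) hx two_ne_zero))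

theorem blaschke_neg_blaschke (ha : ‖a‖ < 1) (hx : ‖x‖ ≤ 1) : blaschke (-a) (blaschke a x) = x := by
  have hden := blaschke_denom_ne_zero ha hx
  have haa : 1 - conj a * a ≠ 0 := blaschke_denom_ne_zero ha ha.le
  have hnum : blaschke a x + a = (1 - conj a * a) * x / (1 - conj a * x) := by
    rw [blaschke, div_add' _ _ _ hden]
    ring
  have hden' : 1 + conj a * blaschke a x = (1 - conj a * a) / (1 - conj a * x) := by
    rw [blaschke, mul_div_assoc', eq_div_iff hden, add_mul, div_mul_cancel₀ _ hden]
    ring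
  rw [blaschke, sub_neg_eq_add, map_neg, neg_mul, sub_neg_eq_add, hnum, hden',
    div_div_div_cancel_right₀ hden, mul_div_cancel_left₀ _ haa]

theorem norm_blaschke_sub_le (ha : ‖a‖ < 1) (hx : ‖x‖ ≤ 1) (hy : ‖y‖ ≤ 1) :
    ‖blaschke a x - blaschke a y‖ ≤ ‖1 - conj a * a‖ / (1 - ‖a‖) ^ 2 * ‖x - y‖ := by
  have hbound {x : ℂ} (hx : ‖x‖ ≤ 1) : 1 - ‖a‖ ≤ ‖1 - conj a * x‖ := by
    have h := norm_sub_norm_le (1 : ℂ) (conj a * x)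
    rw [norm_one, norm_mul, RCLike.norm_conj] at h
    linarith [mul_le_of_le_one_right (norm_nonneg a) hx]
  have hsub : blaschke a x - blaschke a y =
      (1 - conj a * a) * (x - y) / ((1 - conj a * x) * (1 - conj a * y)) := by
    rw [blaschke, blaschke, div_sub_div _ _ (blaschke_denom_ne_zero ha hx)
      (blaschke_denom_ne_zero ha hy)]
    ring
  have : 0 < 1 - ‖a‖ := sub_pos.2 ha
  rw [hsub, norm_div, norm_mul, norm_mul, div_mul_eq_mul_div, sq]
  gcongr
  exacts [hbound hx, hbound hy]

theorem continuousOn_blaschke (ha : ‖a‖ < 1) :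
    ContinuousOn (blaschke a) (Metric.closedBall 0 1) :=
  ContinuousOn.div (by fun_prop) (by fun_prop) fun _ hx =>
    blaschke_denom_ne_zero ha (mem_closedBall_zero_iff.1 hx)

theorem exists_norm_blaschke_le {s : ℝ} (ha : ‖a‖ < 1) (hs : s < 1) :
    ∃ t < 1, ∀ x, ‖x‖ ≤ s → ‖blaschke a x‖ ≤ t := by
  have hcompact : IsCompact (blaschke a '' Metric.closedBall 0 s) :=
    (isCompact_closedBall 0 s).image_of_continuousOn
      ((continuousOn_blaschke ha).mono (Metric.closedBall_subset_closedBall hs.le))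
  obtain ⟨t, ht, hsub⟩ := exists_lt_subset_ball (x := (0 : ℂ)) (r := 1) hcompact.isClosed <| by
    rintro _ ⟨x, hx, rfl⟩
    rw [mem_closedBall_zero_iff] at hx
    exact mem_ball_zero_iff.2 (norm_blaschke_lt_one ha (hx.trans_lt hs))
  exact ⟨t, ht, fun x hx => (mem_ball_zero_iff.1
    (hsub ⟨x, mem_closedBall_zero_iff.2 hx, rfl⟩)).le⟩

theorem IsSchur.differentiableOn_blaschke {g : ℂ → ℂ} (ha : ‖a‖ < 1) (hg : IsSchur 1 g) :
    DifferentiableOn ℂ (fun u => blaschke a (g u)) (Metric.ball 0 1) :=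
  (hg.differentiableOn.sub_const a).div
    ((hg.differentiableOn.const_mul (conj a)).const_sub 1) fun u hu =>
    blaschke_denom_ne_zero ha (hg.norm_le u (mem_ball_zero_iff.1 hu))

end Blaschke

/-- One inverse step of the Schur algorithm: the Schur function with value `-a` at the origin
whose Schur transform is `g`. -/
def schurStep (a : ℂ) (g : ℂ → ℂ) (u : ℂ) : ℂ := blaschke a (u * g u)

/-- The Schur function obtained from `g` by `n` inverse Schur steps, the parameter `α 0` being used
first and hence ending up innermost. -/
def schurIter (α : ℕ → ℂ) (g : ℂ → ℂ) : ℕ → ℂ → ℂ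
  | 0 => g
  | n + 1 => schurStep (α n) (schurIter α g n)

section SchurAlgorithm

variable {a u : ℂ} {α β : ℕ → ℂ} {g h : ℂ → ℂ} {s : ℝ}

theorem isSchur_schurStep (hg : IsSchur 1 g) (ha : ‖a‖ < 1) : IsSchur 1 (schurStep a g) :=
  ⟨hg.id_mul.differentiableOn_blaschke ha, fun u hu =>
    norm_blaschke_le_one ha (hg.id_mul.norm_le u hu)⟩

theorem isSchur_schurIter (hg : IsSchur 1 g) (hα : ∀ n, ‖α n‖ < 1) (n : ℕ) :
    IsSchur 1 (schurIter α g n) := by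
  induction n with
  | zero => exact hg
  | succ n ih => exact isSchur_schurStep ih (hα n)

theorem schurIter_congr {n : ℕ} (hαβ : ∀ i < n, α i = β i) (hgh : g u = h u) :
    schurIter α g n u = schurIter β h n u := by
  induction n with
  | zero => exact hgh
  | succ n ih =>
    simp only [schurIter, schurStep, hαβ n n.lt_succ_self,
      ih fun i hi => hαβ i (hi.trans n.lt_succ_self)]

theorem schurIter_add (α : ℕ → ℂ) (g : ℂ → ℂ) (m n : ℕ) :
    schurIter α g (m + n) = schurIter (fun i => α (m + i)) (schurIter α g m) n := by
  induction n with
  | zero => rfl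
  | succ n ih => rw [← add_assoc, schurIter, ih, schurIter]

theorem schurIter_sub_isBigO (hα : ∀ n, ‖α n‖ < 1) (hg : IsSchur 1 g) (hh : IsSchur 1 h) (n : ℕ) :
    (fun u => schurIter α g n u - schurIter α h n u) =O[𝓝 0] fun u => ‖u‖ ^ n := by
  have hdisc : ∀ᶠ u : ℂ in 𝓝 0, ‖u‖ < 1 := by
    filter_upwards [Metric.ball_mem_nhds (0 : ℂ) one_pos] with u hu using mem_ball_zero_iff.1 hu
  induction n with
  | zero =>
    refine .of_bound 2 (hdisc.mono fun u hu => ?_)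
    simp only [schurIter, pow_zero, norm_one, mul_one]
    linarith [norm_sub_le (g u) (h u), hg.norm_le u hu, hh.norm_le u hu]
  | succ n ih =>
    have hstep : (fun u => schurIter α g (n + 1) u - schurIter α h (n + 1) u) =O[𝓝 0]
        fun u => u * (schurIter α g n u - schurIter α h n u) := by
      refine .of_bound (‖1 - conj (α n) * α n‖ / (1 - ‖α n‖) ^ 2) (hdisc.mono fun u hu => ?_)
      rw [mul_sub]
      exact norm_blaschke_sub_le (hα n) ((isSchur_schurIter hg hα n).id_mul.norm_le u hu)
        ((isSchur_schurIter hh hα n).id_mul.norm_le u hu)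
    simp only [pow_succ']
    exact hstep.trans ((Asymptotics.isBigO_refl _ _).norm_right.mul ih)

theorem norm_schurIter_sub_le (hα : ∀ n, ‖α n‖ < 1) (hg : IsSchur 1 g) (hh : IsSchur 1 h)
    (n : ℕ) (hu : ‖u‖ < 1) : ‖schurIter α g n u - schurIter α h n u‖ ≤ 2 * ‖u‖ ^ n := by
  have hbound {u : ℂ} (hu : ‖u‖ < 1) : ‖schurIter α g n u - schurIter α h n u‖ ≤ 2 := by
    linarith [norm_sub_le (schurIter α g n u) (schurIter α h n u),
      (isSchur_schurIter hg hα n).norm_le u hu, (isSchur_schurIter hh hα n).norm_le u hu]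
  cases n with
  | zero => simpa using hbound hu
  | succ n =>
    let D : ℂ → ℂ := fun u => schurIter α g (n + 1) u - schurIter α h (n + 1) u
    have hD0 : D 0 = 0 := by simp [D, schurIter, schurStep]
    have hsmall : (fun u => D u - D 0) =o[𝓝 0] fun u => ‖u - 0‖ ^ n := by
      simpa only [hD0, sub_zero] using (schurIter_sub_isBigO hα hg hh (n + 1)).trans_isLittleO
        (Asymptotics.isLittleO_norm_pow_norm_pow n.lt_succ_self)
    have hmaps : Set.MapsTo D (Metric.ball 0 1) (Metric.closedBall (D 0) 2) := fun u hu => by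
      rw [hD0, mem_closedBall_zero_iff]
      exact hbound (mem_ball_zero_iff.1 hu)
    have hD : DifferentiableOn ℂ D (Metric.ball 0 1) :=
      (isSchur_schurIter hg hα _).differentiableOn.sub (isSchur_schurIter hh hα _).differentiableOn
    have hschwarz := Complex.dist_le_mul_div_pow_of_mapsTo_ball_of_isLittleO hD hmaps hsmall
      (mem_ball_zero_iff.2 hu)
    rwa [hD0, dist_zero_right, dist_zero_right, div_one] at hschwarz

theorem IsSchur.exists_eq_schurStep (hg : IsSchur s g) (hs : s < 1) :
    ∃ a, ‖a‖ < 1 ∧ ∃ t < 1, ∃ h, IsSchur t h ∧ ∀ u, ‖u‖ < 1 → g u = schurStep a h u := by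
  have h0 : ‖g 0‖ < 1 := (hg.norm_le 0 (by simp)).trans_lt hs
  have hg1 : IsSchur 1 g := hg.mono hs.le
  obtain ⟨t, ht, hbound⟩ := exists_norm_blaschke_le h0 hs
  let φ : ℂ → ℂ := fun u => blaschke (g 0) (g u)
  have hφ0 : φ 0 = 0 := by simp [φ, blaschke]
  have hφ : IsSchur t φ :=
    ⟨hg1.differentiableOn_blaschke h0, fun u hu => hbound _ (hg.norm_le u hu)⟩
  refine ⟨-g 0, by rwa [norm_neg], t, ht, dslope φ 0, hφ.dslope_zero hφ0, fun u hu => ?_⟩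
  rw [schurStep, mul_dslope_zero hφ0,
    blaschke_neg_blaschke h0 (hg1.norm_le u hu)]

theorem IsSchur.exists_eq_schurIter (n : ℕ) (hg : IsSchur s g) (hs : s < 1) :
    ∃ β : ℕ → ℂ, (∀ i, ‖β i‖ < 1) ∧
      ∃ h, IsSchur 1 h ∧ ∀ u, ‖u‖ < 1 → g u = schurIter β h n u := by
  induction n generalizing s g with
  | zero => exact ⟨0, by simp, g, hg.mono hs.le, fun _ _ => rfl⟩
  | succ n ih =>
    obtain ⟨a, ha, t, ht, g₁, hg₁, hgg₁⟩ := hg.exists_eq_schurStep hs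
    obtain ⟨β, hβ, h, hh, hg₁h⟩ := ih hg₁ ht
    refine ⟨Function.update β n a, fun i => ?_, h, hh, fun u hu => ?_⟩
    · rcases eq_or_ne i n with rfl | hi
      · rwa [Function.update_self]
      · rw [Function.update_of_ne hi]
        exact hβ i
    · have hlow : schurIter (Function.update β n a) h n u = g₁ u := by
        rw [hg₁h u hu]
        exact schurIter_congr (fun i hi => Function.update_of_ne hi.ne _ _) rfl
      rw [hgg₁ u hu, schurIter, schurStep,
        schurStep, hlow, Function.update_self]

end SchurAlgorithm

/-! ### Schur functions as limits along a sparse sequence -/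

theorem exists_concat {E : Type*} {s : ℕ → ℕ} (hs : StrictMono s) (β : ℕ → ℕ → E) :
    ∃ α : ℕ → E, (∀ n, ∃ k i, α n = β k i) ∧ ∀ k i, s k + i < s (k + 1) → α (s k + i) = β k i := by
  let block : ℕ → ℕ := fun n => Nat.findGreatest (fun k => s k ≤ n) n
  refine ⟨fun n => β (block n) (n - s (block n)), fun n => ⟨_, _, rfl⟩, fun k i hi => ?_⟩
  have hblock : block (s k + i) = k :=
    Nat.findGreatest_eq_iff.2 ⟨(hs.le_apply).trans (Nat.le_add_right _ _),
      fun _ => Nat.le_add_right _ _, fun j hj _ => not_le.2 (hi.trans_le (hs.monotone hj))⟩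
  dsimp only
  rw [hblock, Nat.add_sub_cancel_left]

theorem exists_tendsto_schurIter {s : ℕ → ℕ} (hs : StrictMono s)
    (hgap : Tendsto (fun k => s (k + 1) - s k) atTop atTop) {g h : ℂ → ℂ} (hg : IsSchur 1 g)
    (hh : IsSchur 1 h) :
    ∃ α : ℕ → ℂ, (∀ n, ‖α n‖ < 1) ∧
      ∀ u, ‖u‖ < 1 → Tendsto (fun k => schurIter α h (s k) u) atTop (𝓝 (g u)) := by
  let r : ℕ → ℝ := fun k => k / (k + 1)
  have hr (k : ℕ) : IsSchur (r k) fun u => r k * g u := by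
    refine ⟨hg.differentiableOn.const_mul _, fun u hu => ?_⟩
    have hrk : 0 ≤ r k := by positivity
    rw [norm_mul, Complex.norm_real, Real.norm_of_nonneg hrk]
    exact mul_le_of_le_one_right hrk (hg.norm_le u hu)
  have hr1 (k : ℕ) : r k < 1 := by
    rw [div_lt_one (by positivity)]
    exact lt_add_one _
  choose β hβ h' hh' hgβ using fun k => (hr k).exists_eq_schurIter (s (k + 1) - s k) (hr1 k)
  obtain ⟨α, hα_mem, hα_block⟩ := exists_concat hs β
  have hα (n : ℕ) : ‖α n‖ < 1 := by
    obtain ⟨k, i, hn⟩ := hα_mem n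
    exact hn ▸ hβ k i
  have hblock (k : ℕ) (u : ℂ) : schurIter α h (s (k + 1)) u =
      schurIter (β k) (schurIter α h (s k)) (s (k + 1) - s k) u := by
    obtain ⟨m, hm⟩ := exists_add_of_le (hs.monotone k.le_succ)
    rw [Nat.succ_eq_add_one] at hm
    rw [hm, schurIter_add, Nat.add_sub_cancel_left]
    exact schurIter_congr (fun i hi => hα_block k i (by omega)) rfl
  refine ⟨α, hα, fun u hu => (tendsto_add_atTop_iff_nat 1).1 ?_⟩
  have hr_lim : Tendsto (fun k => (r k : ℂ) * g u) atTop (𝓝 (g u)) := by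
    simpa [r] using ((Complex.continuous_ofReal.tendsto 1).comp
      (tendsto_natCast_div_add_atTop (1 : ℝ))).mul_const (g u)
  have hpow : Tendsto (fun k => 2 * ‖u‖ ^ (s (k + 1) - s k)) atTop (𝓝 0) := by
    simpa using ((tendsto_pow_atTop_nhds_zero_of_lt_one (norm_nonneg u) hu).comp hgap).const_mul 2
  refine hr_lim.congr_dist (squeeze_zero (fun _ => dist_nonneg) (fun k => ?_) hpow)
  rw [dist_comm, dist_eq_norm, hgβ k u hu, hblock k u]
  exact norm_schurIter_sub_le (hβ k) (isSchur_schurIter hh hα _) (hh' k) _ hu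

/-! ### Reversed polynomials and the Szegő recursion -/

theorem coeff_starReverse (m : ℕ) (P : ℂ[X]) (i : ℕ) :
    (starReverse m P).coeff i = conj (P.coeff (revAt m i)) := by
  simp [starReverse]

theorem natDegree_starReverse_le {m : ℕ} {P : ℂ[X]} (hP : P.natDegree ≤ m) :
    (starReverse m P).natDegree ≤ m := by
  rw [natDegree_le_iff_coeff_eq_zero]
  intro i hi
  rw [coeff_starReverse, revAt_eq_self_of_lt hi, coeff_eq_zero_of_natDegree_lt (by omega), map_zero]

@[simp] theorem starReverse_starReverse (m : ℕ) (P : ℂ[X]) :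
    starReverse m (starReverse m P) = P := by
  ext i
  simp [coeff_starReverse]

theorem starReverse_sub (m : ℕ) (P Q : ℂ[X]) :
    starReverse m (P - Q) = starReverse m P - starReverse m Q := by
  ext i
  simp [coeff_starReverse]

theorem starReverse_C_mul (m : ℕ) (c : ℂ) (P : ℂ[X]) :
    starReverse m (C c * P) = C (conj c) * starReverse m P := by
  ext i
  simp [coeff_starReverse]

theorem starReverse_succ_X_mul {m : ℕ} {P : ℂ[X]} (hP : P.natDegree ≤ m) :
    starReverse (m + 1) (X * P) = starReverse m P := by
  ext i
  rw [coeff_starReverse, coeff_starReverse]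
  rcases lt_trichotomy i (m + 1) with hi | rfl | hi
  · rw [revAt_le hi.le, revAt_le (by omega), show m + 1 - i = m - i + 1 by omega, coeff_X_mul]
  · rw [revAt_le le_rfl, revAt_eq_self_of_lt (by omega), Nat.sub_self, coeff_X_mul_zero,
      coeff_eq_zero_of_natDegree_lt (by omega)]
  · obtain ⟨j, rfl⟩ : ∃ j, i = j + 1 := ⟨i - 1, by omega⟩
    rw [revAt_eq_self_of_lt hi, revAt_eq_self_of_lt (by omega), coeff_X_mul,
      coeff_eq_zero_of_natDegree_lt (by omega), coeff_eq_zero_of_natDegree_lt (by omega)]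

theorem starReverse_succ_starReverse {m : ℕ} {P : ℂ[X]} (hP : P.natDegree ≤ m) :
    starReverse (m + 1) (starReverse m P) = X * P := by
  rw [← starReverse_succ_X_mul hP, starReverse_starReverse]

theorem eval_starReverse {m : ℕ} {P : ℂ[X]} (hP : P.natDegree ≤ m) {z : ℂ} (hz : z ≠ 0) :
    (starReverse m P).eval z = z ^ m * conj (P.eval (conj z)⁻¹) := by
  rw [eval_eq_sum_range' (Nat.lt_succ_of_le (natDegree_starReverse_le hP)),
    eval_eq_sum_range' (Nat.lt_succ_of_le hP), map_sum, Finset.mul_sum,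
    ← Finset.sum_range_reflect]
  refine Finset.sum_congr rfl fun i hi => ?_
  have hi' : i ≤ m := Nat.lt_succ_iff.1 (Finset.mem_range.1 hi)
  rw [coeff_starReverse, show m + 1 - 1 - i = m - i by omega, revAt_le (Nat.sub_le m i),
    Nat.sub_sub_self hi']
  simp only [map_mul, map_pow, map_inv₀, Complex.conj_conj]
  rw [← Nat.sub_add_cancel hi', pow_add, Nat.add_sub_cancel]
  have h1 : z ^ i * z⁻¹ ^ i = 1 := by rw [← mul_pow, mul_inv_cancel₀ hz, one_pow]
  linear_combination (-conj (P.coeff i) * z ^ (m - i)) * h1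

theorem eval_starReverse_of_norm_eq_one {m : ℕ} {P : ℂ[X]} (hP : P.natDegree ≤ m) {w : ℂ}
    (hw : ‖w‖ = 1) : (starReverse m P).eval w = w ^ m * conj (P.eval w) := by
  have hw0 : w ≠ 0 := by rintro rfl; simp at hw
  rw [eval_starReverse hP hw0, ← Complex.inv_eq_conj hw, inv_inv]

theorem eval_starReverse_ne_zero {n : ℕ} {P : ℂ[X]} (hP : P.IsMonicOfDegree n)
    (hne : ∀ z, 1 ≤ ‖z‖ → P.eval z ≠ 0) {u : ℂ} (hu : ‖u‖ ≤ 1) :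
    (starReverse n P).eval u ≠ 0 := by
  rcases eq_or_ne u 0 with rfl | hu0
  · have hlead : P.coeff n = 1 := ((isMonicOfDegree_iff P n).1 hP).2
    rw [← coeff_zero_eq_eval_zero, coeff_starReverse, revAt_le n.zero_le, Nat.sub_zero, hlead,
      map_one]
    exact one_ne_zero
  · rw [eval_starReverse hP.natDegree_eq.le hu0]
    refine mul_ne_zero (pow_ne_zero n hu0) ((_root_.map_ne_zero _).2 (hne _ ?_))
    rw [norm_inv, RCLike.norm_conj]
    exact (one_le_inv₀ (norm_pos_iff.2 hu0)).2 hu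

/-- One step of the Szegő recursion, from degree `n` to degree `n + 1`, with Verblunsky coefficient
`a`. -/
def szegoStep (n : ℕ) (a : ℂ) (P : ℂ[X]) : ℂ[X] := X * P - C (conj a) * starReverse n P

/-- The monic polynomials generated from `1` by the Szegő recursion with Verblunsky coefficients
`α`. -/
def szegoPoly (α : ℕ → ℂ) : ℕ → ℂ[X]
  | 0 => 1
  | n + 1 => szegoStep n (α n) (szegoPoly α n)

section Szego

variable {n : ℕ} {a z : ℂ} {P : ℂ[X]} {α : ℕ → ℂ}

theorem isMonicOfDegree_szegoStep (a : ℂ) (hP : P.IsMonicOfDegree n) :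
    (szegoStep n a P).IsMonicOfDegree (n + 1) := by
  refine IsMonicOfDegree.sub ?_ ?_
  · exact add_comm 1 n ▸ (isMonicOfDegree_X ℂ).mul hP
  · exact ((natDegree_C_mul_le _ _).trans
      (natDegree_starReverse_le hP.natDegree_eq.le)).trans_lt n.lt_succ_self

theorem isMonicOfDegree_szegoPoly (α : ℕ → ℂ) (n : ℕ) : (szegoPoly α n).IsMonicOfDegree n := by
  induction n with
  | zero => exact isMonicOfDegree_zero_iff.2 rfl
  | succ n ih => exact isMonicOfDegree_szegoStep (α n) ih

theorem starReverse_szegoStep (a : ℂ) (hP : P.natDegree ≤ n) :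
    starReverse (n + 1) (szegoStep n a P) = starReverse n P - C a * (X * P) := by
  rw [szegoStep, starReverse_sub, starReverse_succ_X_mul hP, starReverse_C_mul,
    starReverse_succ_starReverse hP, Complex.conj_conj]

theorem eval_szegoStep (n : ℕ) (a : ℂ) (hz : z ≠ 0) (hPz : P.eval z ≠ 0) :
    (szegoStep n a P).eval z =
      z * P.eval z * (1 - conj a * (z⁻¹ * ((starReverse n P).eval z / P.eval z))) := by
  simp only [szegoStep, eval_sub, eval_mul, eval_X, eval_C]
  field_simp

theorem eval_starReverse_szegoStep_div (a : ℂ) (hP : P.natDegree ≤ n) (hz : z ≠ 0)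
    (hPz : P.eval z ≠ 0) :
    (starReverse (n + 1) (szegoStep n a P)).eval z / (szegoStep n a P).eval z =
      blaschke a (z⁻¹ * ((starReverse n P).eval z / P.eval z)) := by
  have hnum : (starReverse n P - C a * (X * P)).eval z =
      z * P.eval z * (z⁻¹ * ((starReverse n P).eval z / P.eval z) - a) := by
    simp only [eval_sub, eval_mul, eval_X, eval_C]
    field_simp
  rw [eval_szegoStep n a hz hPz, starReverse_szegoStep a hP, hnum, blaschke,
    mul_div_mul_left _ _ (mul_ne_zero hz hPz)]

theorem norm_schurIter_one_le (hα : ∀ n, ‖α n‖ < 1) (n : ℕ) {u : ℂ} (hu : ‖u‖ ≤ 1) :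
    ‖schurIter α 1 n u‖ ≤ 1 := by
  induction n with
  | zero => simp [schurIter]
  | succ n ih =>
    refine norm_blaschke_le_one (hα n) ?_
    rw [norm_mul]
    exact mul_le_one₀ hu (norm_nonneg _) ih

theorem eval_starReverse_szegoPoly_div (hα : ∀ n, ‖α n‖ < 1) (n : ℕ) (hz : 1 ≤ ‖z‖) :
    (szegoPoly α n).eval z ≠ 0 ∧
      (starReverse n (szegoPoly α n)).eval z / (szegoPoly α n).eval z = schurIter α 1 n z⁻¹ := by
  have hz0 : z ≠ 0 := norm_pos_iff.1 (one_pos.trans_le hz)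
  have hz1 : ‖z⁻¹‖ ≤ 1 := by
    rw [norm_inv]
    exact inv_le_one_of_one_le₀ hz
  induction n with
  | zero =>
    have hstar : starReverse 0 (1 : ℂ[X]) = 1 := by simp [starReverse, reflect_one]
    simp [szegoPoly, schurIter, hstar]
  | succ n ih =>
    obtain ⟨hne, hratio⟩ := ih
    have hx : ‖z⁻¹ * schurIter α 1 n z⁻¹‖ ≤ 1 := by
      rw [norm_mul]
      exact mul_le_one₀ hz1 (norm_nonneg _) (norm_schurIter_one_le hα n hz1)
    rw [szegoPoly, eval_starReverse_szegoStep_div _ (isMonicOfDegree_szegoPoly α n).natDegree_eq.le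
      hz0 hne, eval_szegoStep n _ hz0 hne, hratio]
    exact ⟨mul_ne_zero (mul_ne_zero hz0 hne) (blaschke_denom_ne_zero (hα n) hx), rfl⟩

theorem eval_szegoPoly_div (hα : ∀ n, ‖α n‖ < 1) (n : ℕ) (hz : 1 ≤ ‖z‖) :
    (szegoPoly α n).eval z / (X * szegoPoly α n + starReverse n (szegoPoly α n)).eval z =
      z⁻¹ * (1 + z⁻¹ * schurIter α 1 n z⁻¹)⁻¹ := by
  obtain ⟨hne, hratio⟩ := eval_starReverse_szegoPoly_div hα n hz
  have hz0 : z ≠ 0 := norm_pos_iff.1 (one_pos.trans_le hz)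
  have hden : (X * szegoPoly α n + starReverse n (szegoPoly α n)).eval z =
      (szegoPoly α n).eval z * (z * (1 + z⁻¹ * schurIter α 1 n z⁻¹)) := by
    rw [← hratio, eval_add, eval_mul, eval_X]
    field_simp
  rw [hden, div_mul_cancel_left₀ hne, mul_inv]

end Szego

/-! ### Orthogonal polynomials -/

theorem conj_pow_mul_pow_of_norm_eq_one {w : ℂ} (hw : ‖w‖ = 1) (n : ℕ) :
    conj w ^ n * w ^ n = 1 := by
  rw [← mul_pow, Complex.conj_mul', hw, Complex.ofReal_one, one_pow, one_pow]

theorem polyInner_C_mul (μ : Measure ℂ) (P : ℂ[X]) (c : ℂ) (Q : ℂ[X]) :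
    polyInner μ P (C c * Q) = c * polyInner μ P Q := by
  simp only [polyInner, eval_mul, eval_C, mul_left_comm _ c]
  exact integral_const_mul _ _

theorem conj_polyInner (μ : Measure ℂ) (P Q : ℂ[X]) : conj (polyInner μ P Q) = polyInner μ Q P := by
  simp only [polyInner, ← integral_conj, map_mul, Complex.conj_conj, mul_comm]

theorem polyInner_eq_zero_comm {μ : Measure ℂ} {P Q : ℂ[X]} :
    polyInner μ P Q = 0 ↔ polyInner μ Q P = 0 := by
  rw [← conj_polyInner, _root_.map_eq_zero]

/-- The squared norm of a polynomial in `L²(ℂ, μ)`. -/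
def polyNormSq (μ : Measure ℂ) (P : ℂ[X]) : ℝ := ∫ w, ‖P.eval w‖ ^ 2 ∂μ

theorem polyInner_self (μ : Measure ℂ) (P : ℂ[X]) : polyInner μ P P = polyNormSq μ P := by
  rw [polyNormSq, ← integral_complex_ofReal, polyInner]
  simp only [Complex.conj_mul', Complex.ofReal_pow]

/-- `P` is orthogonal to `1, X, …, X ^ (n - 1)` in `L²(ℂ, μ)`. -/
def OrthBelow (μ : Measure ℂ) (n : ℕ) (P : ℂ[X]) : Prop :=
  ∀ k < n, polyInner μ (X ^ k) P = 0

section Orthogonality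

variable {μ : Measure ℂ} {P Q : ℂ[X]} {n k : ℕ} {a : ℂ}

theorem integrable_conj_eval_mul_eval (hμ : IsCircleProbability μ) (P Q : ℂ[X]) :
    Integrable (fun w => conj (P.eval w) * Q.eval w) μ :=
  hμ.integrable (by fun_prop)

theorem polyInner_add (hμ : IsCircleProbability μ) (P Q R : ℂ[X]) :
    polyInner μ P (Q + R) = polyInner μ P Q + polyInner μ P R := by
  simp only [polyInner, eval_add, mul_add]
  exact integral_add (integrable_conj_eval_mul_eval hμ P Q) (integrable_conj_eval_mul_eval hμ P R)

theorem polyInner_sub (hμ : IsCircleProbability μ) (P Q R : ℂ[X]) :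
    polyInner μ P (Q - R) = polyInner μ P Q - polyInner μ P R := by
  simp only [polyInner, eval_sub, mul_sub]
  exact integral_sub (integrable_conj_eval_mul_eval hμ P Q) (integrable_conj_eval_mul_eval hμ P R)

theorem polyInner_sum (hμ : IsCircleProbability μ) {ι : Type*} (s : Finset ι) (P : ℂ[X])
    (Q : ι → ℂ[X]) : polyInner μ P (∑ i ∈ s, Q i) = ∑ i ∈ s, polyInner μ P (Q i) := by
  simp only [polyInner, eval_finsetSum, Finset.mul_sum]
  exact integral_finsetSum _ fun i _ => integrable_conj_eval_mul_eval hμ P (Q i)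

theorem polyInner_X_mul_X_mul (hμ : IsCircleProbability μ) (P Q : ℂ[X]) :
    polyInner μ (X * P) (X * Q) = polyInner μ P Q := by
  refine hμ.integral_congr fun w hw => ?_
  have h := conj_pow_mul_pow_of_norm_eq_one hw 1
  simp only [eval_mul, eval_X, map_mul]
  linear_combination (conj (P.eval w) * Q.eval w) * h

theorem polyInner_X_pow_starReverse (hμ : IsCircleProbability μ) (hP : P.natDegree ≤ n)
    (hk : k ≤ n) : polyInner μ (X ^ k) (starReverse n P) = polyInner μ P (X ^ (n - k)) := by
  refine hμ.integral_congr fun w hw => ?_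
  have h := conj_pow_mul_pow_of_norm_eq_one hw k
  rw [eval_starReverse_of_norm_eq_one hP hw]
  nth_rw 1 [← Nat.sub_add_cancel hk]
  simp only [eval_pow, eval_X, pow_add, map_pow]
  linear_combination (conj (P.eval w) * w ^ (n - k)) * h

theorem polyNormSq_X_mul (hμ : IsCircleProbability μ) (P : ℂ[X]) :
    polyNormSq μ (X * P) = polyNormSq μ P :=
  hμ.integral_congr fun w hw => by rw [eval_mul, eval_X, norm_mul, hw, one_mul]

theorem polyNormSq_starReverse (hμ : IsCircleProbability μ) (hP : P.natDegree ≤ n) :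
    polyNormSq μ (starReverse n P) = polyNormSq μ P :=
  hμ.integral_congr fun w hw => by
    rw [eval_starReverse_of_norm_eq_one hP hw, norm_mul, norm_pow, hw, one_pow, one_mul,
      RCLike.norm_conj]

theorem polyNormSq_add_C_mul (hμ : IsCircleProbability μ) (h : polyInner μ P Q = 0) (c : ℂ) :
    polyNormSq μ (P + C c * Q) = polyNormSq μ P + ‖c‖ ^ 2 * polyNormSq μ Q := by
  have hP : polyInner μ (P + C c * Q) P = polyInner μ P P := by
    rw [← conj_polyInner, polyInner_add hμ, polyInner_C_mul, h, mul_zero, add_zero, conj_polyInner]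
  have hQ : polyInner μ (P + C c * Q) Q = conj c * polyInner μ Q Q := by
    rw [← conj_polyInner, polyInner_add hμ, polyInner_C_mul, polyInner_eq_zero_comm.1 h, zero_add,
      map_mul, conj_polyInner]
  have hsq : polyInner μ (P + C c * Q) (P + C c * Q) =
      polyInner μ P P + c * conj c * polyInner μ Q Q := by
    rw [polyInner_add hμ, polyInner_C_mul, hP, hQ, mul_assoc]
  rw [polyInner_self, polyInner_self, polyInner_self, Complex.mul_conj'] at hsq
  exact_mod_cast hsq

theorem polyNormSq_pos (hμ : IsCircleProbability μ) (hinf : μ.support.Infinite) (hP : P ≠ 0) :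
    0 < polyNormSq μ P := by
  refine lt_of_le_of_ne' (integral_nonneg fun _ => sq_nonneg _) fun h => hinf ?_
  have hae : ∀ᵐ w ∂μ, P.eval w = 0 := by
    have hsq := (integral_eq_zero_iff_of_nonneg (μ := μ) (fun w => sq_nonneg ‖P.eval w‖)
      (hμ.integrable (by fun_prop))).1 h
    filter_upwards [hsq] with w hw
    simpa using hw
  have hroots : {w | P.eval w = 0} ⊆ P.roots.toFinset := fun w hw => by simpa [hP] using hw
  exact P.roots.toFinset.finite_toSet.subset ((Measure.support_subset_of_isClosed
    (isClosed_eq P.continuous continuous_const) hae).trans hroots)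

theorem OrthBelow.polyInner_eq_zero (hμ : IsCircleProbability μ) (hP : OrthBelow μ n P)
    (hQ : Q.degree < n) : polyInner μ P Q = 0 := by
  rcases eq_or_ne Q 0 with rfl | hQ0
  · simp [polyInner]
  rw [Q.as_sum_range_C_mul_X_pow' ((natDegree_lt_iff_degree_lt hQ0).2 hQ), polyInner_sum hμ]
  refine Finset.sum_eq_zero fun i hi => ?_
  rw [polyInner_C_mul, polyInner_eq_zero_comm.1 (hP i (Finset.mem_range.1 hi)), mul_zero]

theorem degree_sub_lt_of_isMonicOfDegree (hP : P.IsMonicOfDegree n) (hQ : Q.IsMonicOfDegree n) :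
    (P - Q).degree < n := by
  have hdeg {P : ℂ[X]} (hP : P.IsMonicOfDegree n) : P.degree = n := by
    rw [degree_eq_natDegree hP.ne_zero, hP.natDegree_eq]
  exact hdeg hP ▸ degree_sub_lt_left ((hdeg hP).trans (hdeg hQ).symm) hP.ne_zero
    (hP.leadingCoeff_eq.trans hQ.leadingCoeff_eq.symm)

theorem OrthBelow.polyInner_eq_polyNormSq (hμ : IsCircleProbability μ) (hPo : OrthBelow μ n P)
    (hP : P.IsMonicOfDegree n) (hQ : Q.IsMonicOfDegree n) :
    polyInner μ P Q = polyNormSq μ P := by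
  rw [← polyInner_self, ← sub_eq_zero, ← polyInner_sub hμ]
  exact hPo.polyInner_eq_zero hμ (degree_sub_lt_of_isMonicOfDegree hQ hP)

theorem OrthBelow.eq_of_isMonicOfDegree (hμ : IsCircleProbability μ) (hinf : μ.support.Infinite)
    (hPo : OrthBelow μ n P) (hQo : OrthBelow μ n Q) (hP : P.IsMonicOfDegree n)
    (hQ : Q.IsMonicOfDegree n) : P = Q := by
  by_contra hne
  have hdeg := degree_sub_lt_of_isMonicOfDegree hP hQ
  have hself : polyInner μ (P - Q) (P - Q) = 0 := by
    rw [polyInner_sub hμ, polyInner_eq_zero_comm.1 (hPo.polyInner_eq_zero hμ hdeg),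
      polyInner_eq_zero_comm.1 (hQo.polyInner_eq_zero hμ hdeg), sub_zero]
  rw [polyInner_self, Complex.ofReal_eq_zero] at hself
  exact (polyNormSq_pos hμ hinf (sub_ne_zero.2 hne)).ne' hself

theorem isMonicOfDegree_monicOP (μ : Measure ℂ) (n : ℕ) : (monicOP μ n).IsMonicOfDegree n := by
  induction n using Nat.strong_induction_on with
  | _ n ih =>
    cases n with
    | zero =>
      rw [isMonicOfDegree_zero_iff, monicOP, Fin.sum_univ_zero, sub_zero, pow_zero]
    | succ n =>
      rw [monicOP]
      refine (isMonicOfDegree_X_pow ℂ (n + 1)).sub (Nat.lt_succ_of_le ?_)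
      refine natDegree_sum_le_of_forall_le _ _ fun j _ => (natDegree_C_mul_le _ _).trans ?_
      rw [(ih j j.2).natDegree_eq]
      exact Nat.lt_succ_iff.1 j.2

theorem polyInner_monicOP_of_lt (hμ : IsCircleProbability μ) (hinf : μ.support.Infinite)
    {j : ℕ} (hj : j < n) : polyInner μ (monicOP μ j) (monicOP μ n) = 0 := by
  induction n using Nat.strong_induction_on generalizing j with
  | _ n ih =>
    have hself : polyInner μ (monicOP μ j) (monicOP μ j) ≠ 0 := by
      rw [polyInner_self, Complex.ofReal_ne_zero]
      exact (polyNormSq_pos hμ hinf (isMonicOfDegree_monicOP μ j).ne_zero).ne'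
    rw [monicOP.eq_1 μ n, polyInner_sub hμ, polyInner_sum hμ, Finset.sum_eq_single ⟨j, hj⟩]
    · rw [polyInner_C_mul, div_mul_cancel₀ _ hself, sub_self]
    · intro i _ hij
      rw [polyInner_C_mul]
      rcases lt_or_gt_of_ne (Fin.val_ne_of_ne hij) with h | h
      · rw [polyInner_eq_zero_comm.1 (ih j hj h), mul_zero]
      · rw [ih i i.2 h, mul_zero]
    · exact fun h => absurd (Finset.mem_univ _) h

theorem orthBelow_monicOP (hμ : IsCircleProbability μ) (hinf : μ.support.Infinite) (n : ℕ) :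
    OrthBelow μ n (monicOP μ n) := by
  intro k hk
  have hexpand := eq_sub_iff_add_eq.1 (monicOP.eq_1 μ k)
  rw [polyInner_eq_zero_comm, ← hexpand, polyInner_add hμ, polyInner_sum hμ,
    polyInner_eq_zero_comm.1 (polyInner_monicOP_of_lt hμ hinf hk), zero_add]
  refine Finset.sum_eq_zero fun j _ => ?_
  rw [polyInner_C_mul,
    polyInner_eq_zero_comm.1 (polyInner_monicOP_of_lt hμ hinf (j.2.trans hk)), mul_zero]

theorem OrthBelow.eq_monicOP (hμ : IsCircleProbability μ) (hinf : μ.support.Infinite)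
    (hPo : OrthBelow μ n P) (hP : P.IsMonicOfDegree n) : monicOP μ n = P :=
  (orthBelow_monicOP hμ hinf n).eq_of_isMonicOfDegree hμ hinf hPo (isMonicOfDegree_monicOP μ n) hP

theorem polyNormSq_szegoStep (hμ : IsCircleProbability μ) (hP : P.natDegree ≤ n)
    (h : OrthBelow μ (n + 1) (szegoStep n a P)) :
    polyNormSq μ (szegoStep n a P) = (1 - ‖a‖ ^ 2) * polyNormSq μ P := by
  have hdeg : (starReverse n P).degree < (n + 1 : ℕ) :=
    (degree_le_of_natDegree_le (natDegree_starReverse_le hP)).trans_lt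
      (by exact_mod_cast n.lt_succ_self)
  have hpyth := polyNormSq_add_C_mul hμ (h.polyInner_eq_zero hμ hdeg) (conj a)
  rw [szegoStep, sub_add_cancel, ← szegoStep, polyNormSq_X_mul hμ, polyNormSq_starReverse hμ hP,
    RCLike.norm_conj] at hpyth
  linarith

theorem orthBelow_szegoStep (hμ : IsCircleProbability μ) (hPo : OrthBelow μ n P)
    (hP : P.IsMonicOfDegree n) (ha : conj a * polyNormSq μ P = polyInner μ 1 (X * P)) :
    OrthBelow μ (n + 1) (szegoStep n a P) := by
  intro k hk
  rw [szegoStep, polyInner_sub hμ, polyInner_C_mul,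
    polyInner_X_pow_starReverse hμ hP.natDegree_eq.le (Nat.lt_succ_iff.1 hk)]
  cases k with
  | zero =>
    rw [Nat.sub_zero, hPo.polyInner_eq_polyNormSq hμ hP (isMonicOfDegree_X_pow ℂ n), ha, pow_zero,
      sub_self]
  | succ k =>
    rw [pow_succ', polyInner_X_mul_X_mul hμ, hPo k (by omega),
      polyInner_eq_zero_comm.1 (hPo _ (by omega)), mul_zero, sub_zero]

theorem exists_monicOP_succ_eq_szegoStep (hμ : IsCircleProbability μ) (hinf : μ.support.Infinite)
    (n : ℕ) : ∃ a, ‖a‖ < 1 ∧ monicOP μ (n + 1) = szegoStep n a (monicOP μ n) := by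
  have hP := isMonicOfDegree_monicOP μ n
  have hpos := polyNormSq_pos hμ hinf hP.ne_zero
  obtain ⟨a, ha⟩ : ∃ a, conj a * polyNormSq μ (monicOP μ n) = polyInner μ 1 (X * monicOP μ n) :=
    ⟨conj (polyInner μ 1 (X * monicOP μ n) / polyNormSq μ (monicOP μ n)), by
      rw [Complex.conj_conj, div_mul_cancel₀ _ (Complex.ofReal_ne_zero.2 hpos.ne')]⟩
  have hstep := orthBelow_szegoStep hμ (orthBelow_monicOP hμ hinf n) hP ha
  have hstep_monic := isMonicOfDegree_szegoStep a hP
  refine ⟨a, ?_, hstep.eq_monicOP hμ hinf hstep_monic⟩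
  have hstep_pos := polyNormSq_pos hμ hinf hstep_monic.ne_zero
  rw [polyNormSq_szegoStep hμ hP.natDegree_eq.le hstep] at hstep_pos
  exact (sq_lt_one_iff₀ (norm_nonneg a)).1 (sub_pos.1 (pos_of_mul_pos_left hstep_pos hpos.le))

theorem exists_monicOP_eq_szegoPoly (hμ : IsCircleProbability μ) (hinf : μ.support.Infinite) :
    ∃ α : ℕ → ℂ, (∀ n, ‖α n‖ < 1) ∧ ∀ n, monicOP μ n = szegoPoly α n := by
  choose α hα hstep using exists_monicOP_succ_eq_szegoStep hμ hinf
  refine ⟨α, hα, fun n => ?_⟩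
  induction n with
  | zero => exact isMonicOfDegree_zero_iff.1 (isMonicOfDegree_monicOP μ 0)
  | succ n ih => rw [hstep, ih, szegoPoly]

end Orthogonality

/-! ### Verblunsky's theorem -/

section Verblunsky

variable {μ : Measure ℂ} {P : ℂ[X]} {n : ℕ} {a : ℂ} {α : ℕ → ℂ}

theorem circleAverage_inv_normSq_smul_conj_pow_mul (hP : P.IsMonicOfDegree n)
    (hne : ∀ z, 1 ≤ ‖z‖ → P.eval z ≠ 0) {k : ℕ} (hk : k < n) :
    Real.circleAverage (fun w => (‖P.eval w‖ ^ 2)⁻¹ • (conj w ^ k * P.eval w)) 0 1 = 0 := by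
  let F : ℂ → ℂ := fun w => w ^ (n - k) * ((starReverse n P).eval w)⁻¹
  have hF : DiffContOnCl ℂ F (Metric.ball 0 1) := by
    refine (differentiable_pow (n - k)).diffContOnCl.smul
      ((starReverse n P).differentiable.diffContOnCl.inv fun w hw => ?_)
    exact eval_starReverse_ne_zero hP hne
      (mem_closedBall_zero_iff.1 (Metric.closure_ball_subset_closedBall hw))
  have hmean : Real.circleAverage F 0 1 = 0 := by
    rw [DiffContOnCl.circleAverage (by rwa [abs_one])]
    simp [F, Nat.sub_ne_zero_of_lt hk]
  refine (Real.circleAverage_congr_sphere fun w hw => ?_).trans hmean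
  have hw1 : ‖w‖ = 1 := by simpa using hw
  have hw0 : w ≠ 0 := norm_pos_iff.1 (hw1 ▸ one_pos)
  have hPw : P.eval w ≠ 0 := hne w hw1.ge
  have hPw' : conj (P.eval w) ≠ 0 := (_root_.map_ne_zero _).2 hPw
  have hpow : w ^ n = w ^ (n - k) * w ^ k := by rw [← pow_add, Nat.sub_add_cancel hk.le]
  simp only [F, Complex.real_smul, Complex.ofReal_inv, Complex.ofReal_pow, ← Complex.mul_conj']
  rw [eval_starReverse_of_norm_eq_one hP.natDegree_eq.le hw1, hpow]
  field_simp
  linear_combination conj_pow_mul_pow_of_norm_eq_one hw1 k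

theorem exists_orthBelow (hP : P.IsMonicOfDegree n) (hne : ∀ z, 1 ≤ ‖z‖ → P.eval z ≠ 0) :
    ∃ μ, IsCircleProbability μ ∧ OrthBelow μ n P := by
  -- `μ` is the Bernstein-Szegő measure, whose density is proportional to `‖P w‖⁻²`.
  have hP2 (w : ℂ) (hw : ‖w‖ = 1) : 0 < ‖P.eval w‖ ^ 2 :=
    pow_pos (norm_pos_iff.2 (hne w hw.ge)) 2
  have hD : ContinuousOn (fun w => (‖P.eval w‖ ^ 2)⁻¹) (Metric.sphere 0 1) :=
    ContinuousOn.inv₀ (by fun_prop) fun w hw => (hP2 w (mem_sphere_zero_iff_norm.1 hw)).ne'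
  obtain ⟨μ, hμ, c, hint⟩ := exists_integral_eq_smul_circleAverage hD fun w hw =>
    inv_pos.2 (hP2 w hw)
  refine ⟨μ, hμ, fun k hk => ?_⟩
  simp only [polyInner, eval_pow, eval_X, map_pow]
  rw [hint _ (by fun_prop), circleAverage_inv_normSq_smul_conj_pow_mul hP hne hk, smul_zero]

theorem OrthBelow.of_szegoStep (hμ : IsCircleProbability μ) (ha : ‖a‖ < 1)
    (hP : P.IsMonicOfDegree n) (h : OrthBelow μ (n + 1) (szegoStep n a P)) : OrthBelow μ n P := by
  intro k hk
  have hne : 1 - conj a * a ≠ 0 := blaschke_denom_ne_zero ha ha.le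
  have hinv : C (1 - conj a * a) * (X * P) =
      szegoStep n a P + C (conj a) * starReverse (n + 1) (szegoStep n a P) := by
    rw [starReverse_szegoStep a hP.natDegree_eq.le, szegoStep, C_sub, C_mul, C_1]
    ring
  have hstar : polyInner μ (X ^ (k + 1)) (starReverse (n + 1) (szegoStep n a P)) = 0 := by
    rw [polyInner_X_pow_starReverse hμ (isMonicOfDegree_szegoStep a hP).natDegree_eq.le (by omega)]
    exact polyInner_eq_zero_comm.1 (h _ (by omega))
  have hX : (1 - conj a * a) * polyInner μ (X ^ k) P = 0 := by
    rw [← polyInner_X_mul_X_mul hμ, ← polyInner_C_mul, hinv, ← pow_succ', polyInner_add hμ,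
      polyInner_C_mul, h _ (by omega), hstar, mul_zero, add_zero]
  exact (mul_eq_zero.1 hX).resolve_left hne

theorem exists_forall_orthBelow_szegoPoly (hα : ∀ n, ‖α n‖ < 1) :
    ∃ μ, IsCircleProbability μ ∧ ∀ n, OrthBelow μ n (szegoPoly α n) := by
  choose μ hμ hself using fun n => exists_orthBelow (isMonicOfDegree_szegoPoly α n) fun _ hz =>
    (eval_starReverse_szegoPoly_div hα n hz).1
  have hle {m n : ℕ} (hmn : m ≤ n) : OrthBelow (μ n) m (szegoPoly α m) :=
    Nat.decreasingInduction (motive := fun m _ => OrthBelow (μ n) m (szegoPoly α m))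
      (fun m _ h => h.of_szegoStep (hμ n) (hα m) (isMonicOfDegree_szegoPoly α m)) (hself n) hmn
  obtain ⟨ν, hν, hlim⟩ := exists_tendsto_integral_of_ultrafilter (hyperfilter ℕ) hμ
  refine ⟨ν, hν, fun m k hk => tendsto_nhds_unique (hlim _ (by fun_prop)) ?_⟩
  refine tendsto_const_nhds.congr' ?_
  filter_upwards [Nat.hyperfilter_le_atTop (eventually_ge_atTop m)] with n hn
  exact (hle hn k hk).symm

theorem polyNormSq_szegoPoly_pos (hμ : IsCircleProbability μ) (hα : ∀ n, ‖α n‖ < 1)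
    (h : ∀ n, OrthBelow μ n (szegoPoly α n)) (n : ℕ) : 0 < polyNormSq μ (szegoPoly α n) := by
  induction n with
  | zero =>
    have := hμ.1
    simp [szegoPoly, polyNormSq]
  | succ n ih =>
    rw [szegoPoly,
      polyNormSq_szegoStep hμ (isMonicOfDegree_szegoPoly α n).natDegree_eq.le (h (n + 1))]
    exact mul_pos (sub_pos.2 (pow_lt_one₀ (norm_nonneg _) (hα n) two_ne_zero)) ih

theorem support_infinite_of_orthBelow (hμ : IsCircleProbability μ) {P : ℕ → ℂ[X]}
    (hP : ∀ n, (P n).IsMonicOfDegree n) (horth : ∀ n, OrthBelow μ n (P n))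
    (hpos : ∀ n, 0 < polyNormSq μ (P n)) : μ.support.Infinite := by
  intro hfin
  let Q : ℂ[X] := ∏ w ∈ hfin.toFinset, (X - C w)
  have hQ : Q.IsMonicOfDegree hfin.toFinset.card :=
    ⟨natDegree_finsetProd_X_sub_C_eq_card _ fun w => w, monic_prod_X_sub_C _ _⟩
  have hQ0 : polyInner μ (P hfin.toFinset.card) Q = 0 := by
    refine integral_eq_zero_of_ae (mem_of_superset Measure.support_mem_ae fun w hw => ?_)
    have hQw : Q.eval w = 0 := by
      rw [eval_prod]
      exact Finset.prod_eq_zero (hfin.mem_toFinset.2 hw) (by simp)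
    simp [hQw]
  rw [(horth _).polyInner_eq_polyNormSq hμ (hP _) hQ, Complex.ofReal_eq_zero] at hQ0
  exact (hpos _).ne' hQ0

theorem exists_monicOP_eq_szegoPoly_of_norm_lt_one (hα : ∀ n, ‖α n‖ < 1) :
    ∃ μ, IsCircleProbability μ ∧ μ.support.Infinite ∧ ∀ n, monicOP μ n = szegoPoly α n := by
  obtain ⟨μ, hμ, horth⟩ := exists_forall_orthBelow_szegoPoly hα
  have hmonic := isMonicOfDegree_szegoPoly α
  have hinf := support_infinite_of_orthBelow hμ hmonic horth (polyNormSq_szegoPoly_pos hμ hα horth)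
  exact ⟨μ, hμ, hinf, fun n => (horth n).eq_monicOP hμ hinf (hmonic n)⟩

end Verblunsky

/-! ### Ratios of orthogonal and paraorthogonal polynomials -/

section Ratio

variable {μ ν : Measure ℂ} {α : ℕ → ℂ} {f : ℂ → ℂ}

theorem norm_inv_lt_one {z : ℂ} (hz : 1 < ‖z‖) : ‖z⁻¹‖ < 1 := by
  rw [norm_inv]
  exact inv_lt_one_of_one_lt₀ hz

theorem isCauchyTransform_iff :
    IsCauchyTransform ν f ↔ ∀ z, 1 < ‖z‖ → f z = z⁻¹ * discTransform ν z⁻¹ :=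
  forall₂_congr fun _ hz => by
    rw [integral_one_div_sub ν (norm_pos_iff.1 (one_pos.trans hz))]

theorem isSchur_one : IsSchur 1 1 :=
  ⟨differentiableOn_const 1, fun _ _ => norm_one.le⟩

theorem eval_monicOP_div_eval_paraOP (hα : ∀ n, ‖α n‖ < 1) (hμα : ∀ n, monicOP μ n = szegoPoly α n)
    (n : ℕ) {z : ℂ} (hz : 1 < ‖z‖) :
    (monicOP μ n).eval z / (paraOP μ (n + 1)).eval z =
      z⁻¹ * (1 + z⁻¹ * schurIter α 1 n z⁻¹)⁻¹ := by
  rw [paraOP, Nat.add_sub_cancel, hμα, eval_szegoPoly_div hα n hz.le]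

theorem exists_isCauchyTransform_ratio (hμ : IsCircleProbability μ) (hinf : μ.support.Infinite)
    (n : ℕ) : ∃ ν, IsCircleProbability ν ∧
      IsCauchyTransform ν fun z => (monicOP μ n).eval z / (paraOP μ (n + 1)).eval z := by
  obtain ⟨α, hα, hμα⟩ := exists_monicOP_eq_szegoPoly hμ hinf
  obtain ⟨ν, hν, hνg⟩ := exists_discTransform_eq_inv (isSchur_schurIter isSchur_one hα n)
  refine ⟨ν, hν, isCauchyTransform_iff.2 fun z hz => ?_⟩
  rw [eval_monicOP_div_eval_paraOP hα hμα n hz, hνg _ (norm_inv_lt_one hz)]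

theorem exists_isCauchyTransform_of_tendsto {ι : Type*} {l : Filter ι} [l.NeBot]
    {ν : ι → Measure ℂ} {F : ι → ℂ → ℂ} (hν : ∀ i, IsCircleProbability (ν i))
    (hF : ∀ i, IsCauchyTransform (ν i) (F i))
    (hf : ∀ z, 1 < ‖z‖ → Tendsto (fun i => F i z) l (𝓝 (f z))) :
    ∃ ν, IsCircleProbability ν ∧ IsCauchyTransform ν f := by
  refine exists_eq_integral_of_tendsto (l := l) hν (s := {z | 1 < ‖z‖}) (fun z hz => ?_)
    fun z hz => (hf z hz).congr fun i => hF i z hz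
  refine continuousOn_const.div (by fun_prop) fun w hw => sub_ne_zero.2 ?_
  rintro rfl
  exact (mem_sphere_zero_iff_norm.1 hw).not_gt hz

theorem IsCauchyTransform.exists_tendsto_ratio (hν : IsCircleProbability ν)
    (hf : IsCauchyTransform ν f) {s : ℕ → ℕ} (hs : StrictMono s)
    (hgap : Tendsto (fun k => s (k + 1) - s k) atTop atTop) :
    ∃ μ, IsCircleProbability μ ∧ μ.support.Infinite ∧ ∀ z, 1 < ‖z‖ → Tendsto
      (fun k => (monicOP μ (s k)).eval z / (paraOP μ (s k + 1)).eval z) atTop (𝓝 (f z)) := by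
  obtain ⟨g, hg, hνg⟩ := exists_isSchur_discTransform_eq_inv hν
  obtain ⟨α, hα, hlim⟩ := exists_tendsto_schurIter hs hgap hg isSchur_one
  obtain ⟨μ, hμ, hinf, hμα⟩ := exists_monicOP_eq_szegoPoly_of_norm_lt_one hα
  refine ⟨μ, hμ, hinf, fun z hz => ?_⟩
  have hu := norm_inv_lt_one hz
  simp only [eval_monicOP_div_eval_paraOP hα hμα _ hz]
  rw [isCauchyTransform_iff.1 hf z hz, hνg _ hu]
  exact ((((hlim _ hu).const_mul _).const_add 1).inv₀
    (one_add_mul_ne_zero hu (hg.norm_le _ hu))).const_mul _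

end Ratio

end CirclePolynomials

end

open CirclePolynomials in
theorem theorem3p3_general :
    (∀ μ, IsCircleProbability μ → μ.support.Infinite →
      ∀ {ι : Type*} {l : Filter ι} [l.NeBot] (s : ι → ℕ) (f : ℂ → ℂ),
        (∀ z : ℂ, 1 < ‖z‖ → Tendsto
          (fun i => (monicOP μ (s i)).eval z / (paraOP μ (s i + 1)).eval z) l (𝓝 (f z))) →
        ∃ ν, IsCircleProbability ν ∧ IsCauchyTransform ν f) ∧
    (∀ ν, IsCircleProbability ν → ∀ f, IsCauchyTransform ν f →
      ∀ s : ℕ → ℕ, StrictMono s → Tendsto (fun k => s (k + 1) - s k) atTop atTop →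
        ∃ μ, IsCircleProbability μ ∧ μ.support.Infinite ∧ RatioTendsto μ (fun k => s k + 1) f) := by
  refine ⟨fun μ hμ hinf ι l _ s f hlim => ?_, fun ν hν f hf s hs hgap => ?_⟩
  · choose ν hν hratio using exists_isCauchyTransform_ratio hμ hinf
    exact exists_isCauchyTransform_of_tendsto (fun i => hν (s i)) (fun i => hratio (s i)) hlim
  · exact hf.exists_tendsto_ratio hν hs hgap

theorem theorem3p3 :
    (∀ (μ : MeasureTheory.Measure ℂ), CirclePolynomials.IsCircleProbability μ →
      μ.support.Infinite →
      ∀ (N : ℕ → ℕ), StrictMono N → (∀ k, 1 ≤ N k) →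
      ∀ (f : ℂ → ℂ), CirclePolynomials.RatioTendsto μ N f →
        ∃ ν : MeasureTheory.Measure ℂ, CirclePolynomials.IsCircleProbability ν ∧
          CirclePolynomials.IsCauchyTransform ν f) ∧
    (∀ (ν : MeasureTheory.Measure ℂ), CirclePolynomials.IsCircleProbability ν →
      ∀ (f : ℂ → ℂ), CirclePolynomials.IsCauchyTransform ν f →
        ∃ μ : MeasureTheory.Measure ℂ, CirclePolynomials.IsCircleProbability μ ∧
          μ.support.Infinite ∧
          ∃ N : ℕ → ℕ, StrictMono N ∧ (∀ k, 1 ≤ N k) ∧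
            CirclePolynomials.RatioTendsto μ N f) := by
  refine ⟨fun μ hμ hinf N _ hN f hlim => ?_, fun ν hν f hf => ?_⟩
  · exact theorem3p3_general.1 μ hμ hinf (fun k => N k - 1) f fun z hz => by
      simpa only [Nat.sub_add_cancel (hN _)] using hlim z hz
  · have hpow : StrictMono fun k : ℕ => 2 ^ k := pow_right_strictMono₀ one_lt_two
    obtain ⟨μ, hμ, hinf, hlim⟩ := theorem3p3_general.{0}.2 ν hν f hf _ hpow
      (by simpa [pow_succ, mul_two] using tendsto_pow_atTop_atTop_of_one_lt one_lt_two)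
    exact ⟨μ, hμ, hinf, _, hpow.add_const 1, fun k => Nat.le_add_left 1 _, hlim⟩
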